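/- Let $\mathbb K$ be an algebraically closed field of characteristic $0$ and let $\mathfrak g$ be a finite-dimensional Lie algebra over $\mathbb K$ which is algebraic, i.e. isomorphic to the Lie algebra of an affine algebraic group over $\mathbb K$ (a Zariski-closed subgroup of some $\mathrm{GL}_n(\mathbb K)$). Let $S(\mathfrak g)$ be the symmetric algebra of $\mathfrak g$, viewed as the algebra of polynomial functions on $\mathfrak g^*$. The adjoint action of $\mathfrak g$ extends to $S(\mathfrak g)$, and then to its fraction field $\operatorname{Frac} S(\mathfrak g)$, by derivations; let $S(\mathfrak g)^{\mathfrak g}$ and $(\operatorname{Frac} S(\mathfrak g))^{\mathfrak g}$ be the subalgebra, resp. the subfield, of elements annihilated by all $v\in\mathfrak g$. For $x\in\mathfrak g^*$ let $\mathfrak g(x)=\{v\in\mathfrak g : x([v,w])=0 \text{ for all } w\in\mathfrak g\}$ be its stabilizer for the coadjoint action, and let $\operatorname{ind}\mathfrak g=\min_{x\in\mathfrak g^*}\dim\mathfrak g(x)$. For $p\in S(\mathfrak g)$ and $x\in\mathfrak g^*$, the differential $\mathrm dp(x)$ of $p$ at $x$ is a linear form on $\mathfrak g^*$, hence an element of $\mathfrak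 g$. **Proposition 2.3.** The following conditions are equivalent: 1. $(\operatorname{Frac} S(\mathfrak g))^{\mathfrak g}$ is the fraction field of $S(\mathfrak g)^{\mathfrak g}$ (inside $\operatorname{Frac} S(\mathfrak g)$); 2. $S(\mathfrak g)^{\mathfrak g}$ contains $\operatorname{ind}\mathfrak g$ elements that are algebraically independent over $\mathbb K$; 3. there is a non-empty Zariski-open subset $U$ of $\mathfrak g^*$ such that for every $x\in U$, $\mathfrak g(x)=\{\mathrm dp(x) : p\in S(\mathfrak g)^{\mathfrak g}\}$. -/

import Mathlib

open scoped TensorProduct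

noncomputable section

namespace AlgLie

section Derivations

variable {K : Type*} [CommRing K]

/-- The `K`-linear derivation of the symmetric algebra `S(M)` into an `S(M)`-module `N`
that extends a given `K`-linear map `f : M → N`, obtained from the algebra morphism
`S(M) → S(M) ⊕ N` (trivial square-zero extension) with `m ↦ (m, f m)`. -/
def symDerivation {M N : Type*} [AddCommGroup M] [Module K M] [AddCommGroup N] [Module K N]
    [Module (SymmetricAlgebra K M) N] [IsScalarTower K (SymmetricAlgebra K M) N]
    (f : M →ₗ[K] N) : Derivation K (SymmetricAlgebra K M) N :=
  letI : Module (SymmetricAlgebra K M)ᵐᵒᵖ N :=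
    Module.compHom N ((RingHom.id (SymmetricAlgebra K M)).fromOpposite fun _ _ => mul_comm _ _)
  haveI : IsCentralScalar (SymmetricAlgebra K M) N := ⟨fun _ _ => rfl⟩
  letI F : SymmetricAlgebra K M →ₐ[K] TrivSqZeroExt (SymmetricAlgebra K M) N :=
    SymmetricAlgebra.lift
      ((TrivSqZeroExt.inlAlgHom K (SymmetricAlgebra K M) N).toLinearMap ∘ₗ SymmetricAlgebra.ι K M +
        (TrivSqZeroExt.inrHom (SymmetricAlgebra K M) N).restrictScalars K ∘ₗ f)
  have hF : ∀ p, (F p).fst = p := fun p => by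
    have h : (TrivSqZeroExt.fstHom K (SymmetricAlgebra K M) N).comp F = AlgHom.id K _ := by
      apply SymmetricAlgebra.algHom_ext
      ext m
      simp [F]
    exact congrArg (fun φ : SymmetricAlgebra K M →ₐ[K] SymmetricAlgebra K M => φ p) h
  Derivation.mk'
    { toFun := fun p => (F p).snd
      map_add' := fun p q => by simp
      map_smul' := fun c p => by simp }
    (fun p q => by
      change (F (p * q)).snd = p • (F q).snd + q • (F p).snd
      rw [map_mul, TrivSqZeroExt.snd_mul, hF, hF]
      rfl)

@[simp]
theorem symDerivation_ι {M N : Type*} [AddCommGroup M] [Module K M] [AddCommGroup N] [Module K N]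
    [Module (SymmetricAlgebra K M) N] [IsScalarTower K (SymmetricAlgebra K M) N]
    (f : M →ₗ[K] N) (m : M) : symDerivation f (SymmetricAlgebra.ι K M m) = f m := by
  simp [symDerivation, Derivation.mk']

/-- The extension of a `K`-linear derivation of a domain `A` to a derivation of its fraction field
(by the quotient rule), obtained from the ring morphism `A → L ⊕ L ε`, `a ↦ a + (D a) ε`, where
`L` is the fraction field of `A`. -/
def fracDerivation {A : Type*} [CommRing A] [IsDomain A] [Algebra K A] (D : Derivation K A A) :
    Derivation K (FractionRing A) (FractionRing A) :=
  letI F₀ : A →ₐ[K] TrivSqZeroExt (FractionRing A) (FractionRing A) :=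
    { toFun := fun a => (algebraMap A (FractionRing A) a, algebraMap A (FractionRing A) (D a))
      map_one' := by ext <;> simp
      map_mul' := fun a b => by
        apply TrivSqZeroExt.ext
        · change algebraMap A (FractionRing A) (a * b) = _ * _
          exact map_mul _ _ _
        · change algebraMap A (FractionRing A) (D (a * b)) =
            algebraMap A (FractionRing A) a * algebraMap A (FractionRing A) (D b) +
              algebraMap A (FractionRing A) (D a) * algebraMap A (FractionRing A) b
          simp [D.leibniz, mul_comm]
      map_zero' := by
        apply TrivSqZeroExt.ext
        · exact map_zero _
        · change algebraMap A (FractionRing A) (D 0) = 0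
          simp
      map_add' := fun a b => by
        apply TrivSqZeroExt.ext
        · exact map_add _ _ _
        · change algebraMap A (FractionRing A) (D (a + b)) =
            algebraMap A (FractionRing A) (D a) + algebraMap A (FractionRing A) (D b)
          simp
      commutes' := fun c => by
        apply TrivSqZeroExt.ext
        · exact (IsScalarTower.algebraMap_apply K A (FractionRing A) c).symm
        · change algebraMap A (FractionRing A) (D (algebraMap K A c)) = 0
          simp }
  letI F : FractionRing A →ₐ[K] TrivSqZeroExt (FractionRing A) (FractionRing A) :=
    IsLocalization.liftAlgHom (M := nonZeroDivisors A) (f := F₀) fun y => by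
      rw [TrivSqZeroExt.isUnit_iff_isUnit_fst]
      exact (IsLocalization.map_units (FractionRing A) y)
  have hF₀ : ∀ a, F (algebraMap A (FractionRing A) a) = F₀ a := fun a => by
    simp [F]
  have hF : ∀ p, (F p).fst = p := fun p => by
    have h : (TrivSqZeroExt.fstHom K (FractionRing A) (FractionRing A)).comp F =
        AlgHom.id K _ := by
      apply IsLocalization.algHom_ext (nonZeroDivisors A)
      ext a
      exact congrArg TrivSqZeroExt.fst (hF₀ a)
    exact congrArg (fun φ : FractionRing A →ₐ[K] FractionRing A => φ p) h
  Derivation.mk'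
    { toFun := fun p => (F p).snd
      map_add' := fun p q => by simp
      map_smul' := fun c p => by simp }
    (fun p q => by
      change (F (p * q)).snd = p • (F q).snd + q • (F p).snd
      rw [map_mul, TrivSqZeroExt.snd_mul, hF, hF, op_smul_eq_smul])

theorem fracDerivation_algebraMap {A : Type*} [CommRing A] [IsDomain A] [Algebra K A]
    (D : Derivation K A A) (a : A) :
    fracDerivation D (algebraMap A (FractionRing A) a) = algebraMap A (FractionRing A) (D a) := by
  simp [fracDerivation, Derivation.mk']
  rfl

end Derivations

variable (K g : Type*) [Field K] [LieRing g] [LieAlgebra K g]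

/-- The adjoint action of `v` on `S(g)`: the derivation of `S(g)` extending `ad v`. -/
def adAction (v : g) : Derivation K (SymmetricAlgebra K g) (SymmetricAlgebra K g) :=
  symDerivation (SymmetricAlgebra.ι K g ∘ₗ (LieAlgebra.ad K g v : g →ₗ[K] g))

/-- The subalgebra `S(g)^g` of invariants of `S(g)` for the adjoint action. -/
def invariants : Subalgebra K (SymmetricAlgebra K g) where
  carrier := {p | ∀ v : g, adAction K g v p = 0}
  mul_mem' {p q} hp hq v := by simp [hp v, hq v]
  add_mem' {p q} hp hq v := by simp [hp v, hq v]
  algebraMap_mem' c v := by simp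

/-- The field of invariants in `Frac S(g)` for the adjoint action, where `v ∈ g` acts by the unique
extension of its action on `S(g)` to a derivation of `Frac S(g)`. -/
def invariantField : IntermediateField K (FractionRing (SymmetricAlgebra K g)) where
  carrier := {f | ∀ v : g, fracDerivation (adAction K g v) f = 0}
  mul_mem' {p q} hp hq v := by simp [hp v, hq v]
  add_mem' {p q} hp hq v := by simp [hp v, hq v]
  algebraMap_mem' c v := by simp
  inv_mem' f hf v := by simp [Derivation.leibniz_inv, hf v]

/-- The fraction field of `S(g)^g`, as the smallest subfield of `Frac S(g)` that contains
`S(g)^g` (and `K`). -/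
def fracInvariants : IntermediateField K (FractionRing (SymmetricAlgebra K g)) :=
  IntermediateField.adjoin K
    (algebraMap (SymmetricAlgebra K g) (FractionRing (SymmetricAlgebra K g)) ''
      (invariants K g : Set (SymmetricAlgebra K g)))

variable {g}

/-- The value at `x ∈ g*` of `p ∈ S(g)`, viewed as a polynomial function on `g*`. -/
def evalAt (x : Module.Dual K g) : SymmetricAlgebra K g →ₐ[K] K :=
  SymmetricAlgebra.lift x

/-- The differential `dp ∈ S(g) ⊗ g` of `p ∈ S(g)`; on `v ∈ g` it is `1 ⊗ v`. -/
def differential :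
    Derivation K (SymmetricAlgebra K g) (SymmetricAlgebra K g ⊗[K] g) :=
  symDerivation (TensorProduct.mk K (SymmetricAlgebra K g) g 1)

/-- The differential `dp(x)` of `p` at `x ∈ g*`, a linear form on `g*`, i.e. an element of `g`. -/
def differentialAt (x : Module.Dual K g) (p : SymmetricAlgebra K g) : g :=
  TensorProduct.lid K g ((evalAt K x).toLinearMap.rTensor g (differential K p))

/-- The stabilizer `g(x)` of `x ∈ g*` for the coadjoint action `(v · x)(w) = -x([v, w])`. -/
def stabilizer (x : Module.Dual K g) : Submodule K g where
  carrier := {v | ⁅v, x⁆ = 0}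
  add_mem' {v w} hv hw := by
    change ⁅v + w, x⁆ = 0
    change ⁅v, x⁆ = 0 at hv
    change ⁅w, x⁆ = 0 at hw
    rw [add_lie, hv, hw, add_zero]
  zero_mem' := by simp
  smul_mem' c v hv := by
    change ⁅c • v, x⁆ = 0
    change ⁅v, x⁆ = 0 at hv
    rw [smul_lie, hv, smul_zero]

variable (g) in
/-- The index of `g`: the smallest dimension of a stabilizer for the coadjoint action. -/
def index : ℕ := ⨅ x : Module.Dual K g, Module.finrank K (stabilizer K x)

/-- Zariski-open subsets of `g*`: the complements of the zero sets of families of polynomials. -/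
def IsZariskiOpen (U : Set (Module.Dual K g)) : Prop :=
  ∃ T : Set (SymmetricAlgebra K g), U = {x | ∃ p ∈ T, evalAt K x p ≠ 0}

variable {K}

/-- A subgroup of `GL_n(K)` is algebraic if it is Zariski closed in `GL_n(K)`, i.e. cut out by
polynomials in the matrix entries. -/
def IsAlgebraicSubgroup {n : ℕ} (G : Subgroup (GL (Fin n) K)) : Prop :=
  ∃ T : Set (MvPolynomial (Fin n × Fin n) K),
    ∀ a : GL (Fin n) K, a ∈ G ↔ ∀ p ∈ T, MvPolynomial.eval (fun ij => a.val ij.1 ij.2) p = 0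

/-- The Lie algebra of an algebraic subgroup `G ⊆ GL_n(K)` as a set of matrices: the tangent space
of `G` at the identity, i.e. the matrices killed by the differentials at the identity of all
polynomials vanishing on `G`. -/
def lieAlgebraOf {n : ℕ} (G : Subgroup (GL (Fin n) K)) : Set (Matrix (Fin n) (Fin n) K) :=
  {X | ∀ p : MvPolynomial (Fin n × Fin n) K,
    (∀ a ∈ G, MvPolynomial.eval (fun ij => a.val ij.1 ij.2) p = 0) →
      ∑ ij : Fin n × Fin n, MvPolynomial.eval
        (fun kl => (1 : Matrix (Fin n) (Fin n) K) kl.1 kl.2) (MvPolynomial.pderiv ij p) *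
          X ij.1 ij.2 = 0}

variable (K g) in
/-- `g` is algebraic: it is isomorphic to the Lie algebra of a linear (equivalently, affine)
algebraic group `G`, a closed subgroup of some `GL_n(K)`. The isomorphism is an injective linear
map `ρ` into the matrices, carrying the bracket to the commutator, whose image is `Lie G`. -/
def IsAlgebraic : Prop :=
  ∃ (n : ℕ) (G : Subgroup (GL (Fin n) K)) (ρ : g →ₗ[K] Matrix (Fin n) (Fin n) K),
    IsAlgebraicSubgroup G ∧ Function.Injective ρ ∧
      (∀ v w : g, ρ ⁅v, w⁆ = ρ v * ρ w - ρ w * ρ v) ∧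
      Set.range ρ = lieAlgebraOf G

end AlgLie

end

/-! Let `n = dim g`, let `L = Frac S(g)`, and let `r` be the rank over `L` of the Poisson matrix
`([b i, b j])`. The dimension of `g(x)` is `n` minus the rank of this matrix at `x`, and
specialization can only lower a rank, so `ind g = n - r` (`index_add_genericRank`).

Everything rests on comparing `r` with the transcendence degree of `L` over the field of invariants.
The `L`-combinations of the derivations `ad v` form an `r`-dimensional space of derivations killing
the invariants, so this degree is at least `r` (`genericRank_le_card`) and the field of invariants
has degree at most `ind g` over `K`. Hence `ind g` independent invariants form a transcendence basis
of it, and integral closedness of `S(g)` gives 2 → 1. The Jacobian criterion in characteristic zero,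
together with `dp(x) ∈ g(x)` for invariant `p`, gives 2 ↔ 3.

For 1 → 2 the degree must also be at most `r`; this is where algebraicity enters
(`card_le_genericRank`, in the role of Rosenlicht's theorem). If elements `x k` of `g` are
independent over the invariants, the functions `a ↦ a⁻¹ (x k) a` on `G` are independent over `L`:
their relations form an `L`-space stable under differentiating coefficients by `ad w`, so a
normalized relation of minimal support has invariant coefficients, which is absurd at `a = 1`.
Passing to a field `E` over `L` yields a point `γ` of `G` and `L`-derivations `D j` dual to the
elements `γ⁻¹ (x k) γ`. Since `γ⁻¹ D j(γ)` lies in `Lie(G) ⊗ E`, differentiating `γ⁻¹ (x k) γ` gives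
a bracket, and duality factors the identity matrix through the Poisson matrix. So there are at most
`r` of the `x k`. -/

noncomputable section

namespace AlgLie

/-! ### Derivations of fields and algebraic independence in characteristic zero. -/

section FieldTheory

/-- The algebra morphism `a ↦ a + (D a) ε` attached to a derivation `D`. -/
def derivationHom {K A : Type*} [CommRing K] [CommRing A] [Algebra K A] (D : Derivation K A A) :
    A →ₐ[K] TrivSqZeroExt A A where
  toFun a := TrivSqZeroExt.inl a + TrivSqZeroExt.inr (D a)
  map_one' := by ext <;> simp
  map_mul' a b := by ext <;> simp [D.leibniz, mul_comm]
  map_zero' := by ext <;> simp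
  map_add' a b := by ext <;> simp
  commutes' c := by ext <;> simp [TrivSqZeroExt.algebraMap_eq_inl']

/-- The field of constants of a derivation of a field. -/
def derivationConstants {K E : Type*} [Field K] [Field E] [Algebra K E] (D : Derivation K E E) :
    IntermediateField K E where
  carrier := {f | D f = 0}
  mul_mem' {p q} hp hq := by
    simp only [Set.mem_ofPred_eq] at hp hq ⊢
    simp [hp, hq]
  add_mem' {p q} hp hq := by
    simp only [Set.mem_ofPred_eq] at hp hq ⊢
    simp [hp, hq]
  algebraMap_mem' c := by simp
  inv_mem' f hf := by
    simp only [Set.mem_ofPred_eq] at hf ⊢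
    simp [Derivation.leibniz_inv, hf]

/-- A derivation that kills an intermediate field `F`, as an `F`-linear derivation. -/
def derivationOver {K E : Type*} [Field K] [Field E] [Algebra K E] (D : Derivation K E E)
    {F : IntermediateField K E} (hF : ∀ f ∈ F, D f = 0) : Derivation F E E :=
  Derivation.mk'
    { toFun := D
      map_add' := fun x y => by simp
      map_smul' := fun c x => by
        change D (c.1 * x) = c.1 * D x
        rw [D.leibniz, hF c.1 c.2]
        simp }
    (fun x y => by simp)

/-- Applying `D` to `μ(a) = 0`, with `μ` the minimal polynomial over the constants, gives `μ'(a) * D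
a = 0`, and `μ'(a) ≠ 0` by separability. -/
theorem derivation_eq_zero_of_isAlgebraic {K E : Type*} [Field K] [CharZero K] [Field E]
    [Algebra K E] (D : Derivation K E E) {a : E}
    (ha : _root_.IsAlgebraic (derivationConstants D) a) : D a = 0 := by
  have : CharZero E := charZero_of_injective_algebraMap (algebraMap K E).injective
  set F := derivationConstants D
  let D' : Derivation F E E := derivationOver D fun f hf => hf
  have hsep : (Polynomial.aeval a (Polynomial.derivative (minpoly F a))) ≠ 0 := by
    have := (minpoly.irreducible ha.isIntegral).separable
    exact this.aeval_derivative_ne_zero (minpoly.aeval F a)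
  have h : D' (Polynomial.aeval a (minpoly F a)) = 0 := by rw [minpoly.aeval]; exact map_zero _
  rw [Derivation.map_aeval] at h
  exact (smul_eq_zero.1 h).resolve_left hsep

theorem derivation_eq_zero_of_isAlgebraic_adjoin {K E : Type*} [Field K] [CharZero K] [Field E]
    [Algebra K E] (D : Derivation K E E) {s : Set E} (hs : ∀ t ∈ s, D t = 0) {a : E}
    (ha : _root_.IsAlgebraic (Algebra.adjoin K s) a) : D a = 0 := by
  apply derivation_eq_zero_of_isAlgebraic
  have hle : Algebra.adjoin K s ≤ (derivationConstants D).toSubalgebra :=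
    Algebra.adjoin_le fun t ht => hs t ht
  let _ : Algebra (Algebra.adjoin K s) (derivationConstants D) :=
    (Subalgebra.inclusion hle).toRingHom.toAlgebra
  have : IsScalarTower (Algebra.adjoin K s) (derivationConstants D) E :=
    IsScalarTower.of_algebraMap_eq (congrFun rfl)
  exact _root_.IsAlgebraic.extendScalars (R := Algebra.adjoin K s) (Subalgebra.inclusion_injective hle) ha

/-- Stated for ring morphisms because the `A`-algebra structure on `B` is the one defined by `f`,
which will encode the prescribed values of a derivation. -/
theorem exists_ringHom_lift_of_formallySmooth {A E B : Type*} [CommRing A] [CommRing E]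
    [CommRing B] [Algebra A E] [Algebra.FormallySmooth A E] (f : A →+* B) (p : B →+* E)
    (hp : Function.Surjective p) (hker : ∀ x y, p x = 0 → p y = 0 → x * y = 0)
    (hf : ∀ a, p (f a) = algebraMap A E a) :
    ∃ σ : E →+* B, (∀ e, p (σ e) = e) ∧ ∀ a, σ (algebraMap A E a) = f a := by
  let _ : Algebra A B := f.toAlgebra
  let p' : B →ₐ[A] E := { p with commutes' := hf }
  have hnil : IsNilpotent (RingHom.ker (p' : B →+* E)) := by
    refine ⟨2, ?_⟩
    rw [pow_two, Submodule.zero_eq_bot, eq_bot_iff, Ideal.mul_le]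
    intro x hx y hy
    exact hker x y hx hy
  refine ⟨(Algebra.FormallySmooth.liftOfSurjective (AlgHom.id A E) p' hp hnil).toRingHom,
    fun e => ?_, fun a => ?_⟩
  · exact Algebra.FormallySmooth.liftOfSurjective_apply (AlgHom.id A E) p' hp hnil e
  · exact (Algebra.FormallySmooth.liftOfSurjective (AlgHom.id A E) p' hp hnil).commutes a

open scoped IntermediateField.algebraAdjoinAdjoin in
-- Two steps: the localization from `K[v]` to `K(v)`, then the separable algebraic extension from
-- `K(v)` to `E`, which is formally étale.
theorem formallySmooth_adjoin_of_isTranscendenceBasis {K E ι : Type*} [Field K] [CharZero K]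
    [Field E] [Algebra K E] {v : ι → E} (hv : IsTranscendenceBasis K v) :
    Algebra.FormallySmooth (Algebra.adjoin K (Set.range v)) E := by
  have h1 : Algebra.FormallySmooth (Algebra.adjoin K (Set.range v))
      (IntermediateField.adjoin K (Set.range v)) :=
    .of_isLocalization (nonZeroDivisors _)
  have := hv.isAlgebraic_field
  have h2 : Algebra.FormallyEtale (IntermediateField.adjoin K (Set.range v)) E :=
    Algebra.FormallyEtale.of_isSeparable _ E
  exact .comp _ (IntermediateField.adjoin K (Set.range v)) _

/-- A derivation is a section `σ` of `E[ε] → E`. The assignment `v i ↦ v i + ε c i` defines it on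
`K[v]`, and formal smoothness extends it to `E`. -/
theorem exists_derivation_of_isTranscendenceBasis {K E ι : Type*} [Field K] [CharZero K]
    [Field E] [Algebra K E] {v : ι → E} (hv : IsTranscendenceBasis K v) (c : ι → E) :
    ∃ D : Derivation K E E, ∀ i, D (v i) = c i := by
  have := formallySmooth_adjoin_of_isTranscendenceBasis hv
  let f₀ : MvPolynomial ι K →ₐ[K] TrivSqZeroExt E E :=
    MvPolynomial.aeval fun i => TrivSqZeroExt.inl (v i) + TrivSqZeroExt.inr (c i)
  let f : Algebra.adjoin K (Set.range v) →ₐ[K] TrivSqZeroExt E E :=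
    f₀.comp hv.1.aevalEquiv.symm.toAlgHom
  have hf₀ : ∀ q, (f₀ q).fst = MvPolynomial.aeval v q := fun q => by
    have h : (TrivSqZeroExt.fstHom K E E).comp f₀ = MvPolynomial.aeval v := by
      ext i
      simp [f₀]
    exact congrArg (fun φ : MvPolynomial ι K →ₐ[K] E => φ q) h
  have hf : ∀ a, (f a).fst = algebraMap _ E a := fun a => by
    obtain ⟨q, rfl⟩ := hv.1.aevalEquiv.surjective a
    simp [f, hf₀]
  obtain ⟨σ, h1, h2⟩ := exists_ringHom_lift_of_formallySmooth f.toRingHom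
    (TrivSqZeroExt.fstHom K E E).toRingHom (fun e => ⟨TrivSqZeroExt.inl e, rfl⟩)
    (fun x y hx hy => by
      have hx' : x.fst = 0 := hx
      have hy' : y.fst = 0 := hy
      ext <;> simp [hx', hy']) hf
  replace h1 : ∀ e, (σ e).fst = e := h1
  have hK : ∀ k : K, σ (algebraMap K E k) = algebraMap K _ k := fun k => by
    have := h2 (algebraMap K _ k)
    rw [← IsScalarTower.algebraMap_apply] at this
    rw [this]
    exact f.commutes k
  let D : Derivation K E E := Derivation.mk'
    { toFun := fun e => (σ e).snd
      map_add' := fun x y => by simp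
      map_smul' := fun k x => by
        rw [Algebra.smul_def, map_mul, TrivSqZeroExt.snd_mul, hK, h1]
        simp [TrivSqZeroExt.algebraMap_eq_inl', Algebra.smul_def] }
    (fun x y => by
      change (σ (x * y)).snd = x • (σ y).snd + y • (σ x).snd
      rw [map_mul, TrivSqZeroExt.snd_mul, h1, h1, op_smul_eq_smul])
  refine ⟨D, fun i => ?_⟩
  have := h2 (hv.1.aevalEquiv (MvPolynomial.X i))
  rw [show (algebraMap _ E (hv.1.aevalEquiv (MvPolynomial.X i))) = v i by simp] at this
  change (σ (v i)).snd = c i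
  rw [this]
  simp [f, f₀]

theorem exists_derivation_of_algebraicIndependent {K E ι : Type*} [Field K] [CharZero K]
    [Field E] [Algebra K E] {v : ι → E} (hv : AlgebraicIndependent K v) (c : ι → E) :
    ∃ D : Derivation K E E, ∀ i, D (v i) = c i := by
  classical
  obtain ⟨t, hst, ht⟩ := exists_isTranscendenceBasis_superset hv.to_subtype_range
  have hinj := hv.injective
  -- The elements added to complete `v` to a transcendence basis receive the value `0`.
  obtain ⟨D, hD⟩ := exists_derivation_of_isTranscendenceBasis ht
    (fun x => if h : ∃ i, v i = x then c h.choose else 0)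
  refine ⟨D, fun i => ?_⟩
  have hi : ∃ j, v j = v i := ⟨i, rfl⟩
  have := hD ⟨v i, hst ⟨i, rfl⟩⟩
  rw [dif_pos hi, hinj hi.choose_spec] at this
  exact this

/-- A family with a dual family of derivations is algebraically independent. -/
theorem algebraicIndependent_of_derivations {K E ι : Type*} [Field K] [CharZero K]
    [Field E] [Algebra K E] [DecidableEq ι] (v : ι → E) (D : ι → Derivation K E E)
    (hD : ∀ i j, D i (v j) = if i = j then 1 else 0) : AlgebraicIndependent K v := by
  -- If `v i` were algebraic over other members of the family, `D i`, which kills those, would kill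
  -- `v i` too.
  refine algebraicIndependent_of_finite_type' (algebraMap K E).injective
    fun t _ _ i hi halg => ?_
  have h0 : D i (v i) = 0 := derivation_eq_zero_of_isAlgebraic_adjoin (D i)
    (s := v '' t) (by
      rintro _ ⟨j, hj, rfl⟩
      rw [hD, if_neg]
      rintro rfl
      exact hi hj) halg
  rw [hD, if_pos rfl] at h0
  exact one_ne_zero h0

end FieldTheory

/-! ### Ranks of matrices under specialization. -/

section MatrixRank

open Matrix

theorem exists_rank_factorization {F m n : Type*} [Field F] [Fintype m] [Fintype n]
    (M : Matrix m n F) :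
    ∃ (P : Matrix m (Fin M.rank) F) (Q : Matrix (Fin M.rank) n F), M = P * Q := by
  classical
  let w : Module.Basis (Fin M.rank) F (LinearMap.range M.mulVecLin) :=
    Module.finBasisOfFinrankEq F _ rfl
  refine ⟨Matrix.of fun i k => (w k).1 i,
    Matrix.of fun k j => w.repr ⟨M *ᵥ Pi.single j 1, Pi.single j 1, rfl⟩ k, ?_⟩
  ext i j
  have h := congrArg (fun v : LinearMap.range M.mulVecLin => v.1 i)
    (w.sum_repr ⟨M *ᵥ Pi.single j 1, Pi.single j 1, rfl⟩)
  simp only [Submodule.coe_sum, Submodule.coe_smul, Finset.sum_apply, Pi.smul_apply,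
    smul_eq_mul, Matrix.mulVec_single_one] at h
  simp only [Matrix.mul_apply, Matrix.of_apply, Matrix.mulVec_single_one]
  rw [← Matrix.col_apply M j i, ← h]
  exact Finset.sum_congr rfl fun k _ => mul_comm _ _

theorem exists_mul_eq_one_of_rank_eq_card {F m n : Type*} [Field F] [Fintype m] [Fintype n]
    [DecidableEq n] {P : Matrix m n F} (hP : P.rank = Fintype.card n) :
    ∃ B : Matrix n m F, B * P = 1 := by
  classical
  have hPi : Function.Injective P.mulVecLin := by
    rw [← LinearMap.ker_eq_bot, ← Submodule.finrank_eq_zero]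
    have := P.mulVecLin.finrank_range_add_finrank_ker
    rw [← Matrix.rank, hP] at this
    simpa using this
  obtain ⟨B, hB⟩ := P.mulVecLin.exists_leftInverse_of_injective (LinearMap.ker_eq_bot.2 hPi)
  refine ⟨LinearMap.toMatrix' B, ?_⟩
  rw [← LinearMap.toMatrix'_toLin' P, Matrix.toLin'_apply', ← LinearMap.toMatrix'_comp, hB,
    LinearMap.toMatrix'_id]

/-- The identity `B * M * C = 1` certifies a lower bound on the rank. It can be lifted along
surjections and cleared of denominators, which gives the two specialization lemmas below. -/
theorem exists_mul_mul_eq_one {F m n : Type*} [Field F] [Fintype m] [Fintype n]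
    (M : Matrix m n F) :
    ∃ (B : Matrix (Fin M.rank) m F) (C : Matrix n (Fin M.rank) F), B * M * C = 1 := by
  classical
  obtain ⟨P, Q, h⟩ := exists_rank_factorization M
  have hP : P.rank = M.rank := le_antisymm (by simpa using P.rank_le_card_width)
    (by conv_lhs => rw [h]
        exact Matrix.rank_mul_le_left P Q)
  have hQ : Q.rank = M.rank := le_antisymm (by simpa using Q.rank_le_card_height)
    (by conv_lhs => rw [h]
        exact Matrix.rank_mul_le_right P Q)
  obtain ⟨B, hB⟩ := exists_mul_eq_one_of_rank_eq_card (P := P) (by simpa using hP)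
  obtain ⟨C, hC⟩ := exists_mul_eq_one_of_rank_eq_card (P := Q.transpose)
    (by rw [Matrix.rank_transpose]; simpa using hQ)
  refine ⟨B, C.transpose, (congrArg (fun X => B * X * C.transpose) h).trans ?_⟩
  rw [← Matrix.mul_assoc, hB, Matrix.one_mul, ← Matrix.transpose_inj, Matrix.transpose_mul,
    Matrix.transpose_transpose, hC, Matrix.transpose_one]

theorem le_rank_of_mul_mul_eq_smul_one {F m n l : Type*} [Field F] [Fintype m] [Fintype n]
    [Fintype l] [DecidableEq l] {M : Matrix m n F} {B : Matrix l m F} {C : Matrix n l F} {c : F}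
    (hc : c ≠ 0) (h : B * M * C = c • (1 : Matrix l l F)) : Fintype.card l ≤ M.rank := by
  have h1 : (c • (1 : Matrix l l F)).rank = Fintype.card l := by
    apply Matrix.rank_of_det_ne_zero
    simp [hc]
  rw [← h1, ← h]
  exact (Matrix.rank_mul_le_left _ _).trans (Matrix.rank_mul_le_right _ _)

theorem rank_map_le {F F' m n : Type*} [Field F] [Field F'] [Fintype m] [Fintype n]
    (f : F →+* F') (M : Matrix m n F) : (M.map f).rank ≤ M.rank := by
  obtain ⟨P, Q, h⟩ := exists_rank_factorization M
  have : M.map f = P.map f * Q.map f := by conv_lhs => rw [h, Matrix.map_mul]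
  rw [this]
  refine (Matrix.rank_mul_le_left _ _).trans ((Matrix.rank_le_card_width _).trans ?_)
  simp

/-- A certificate over `F` lifts entrywise to `A`; the determinant of the lifted product maps to
`1`, hence is nonzero over the fraction field. -/
theorem rank_map_le_rank_map_algebraMap {A F m n : Type*} [CommRing A] [IsDomain A] [Field F]
    [Fintype m] [Fintype n] (ψ : A →+* F) (hψ : Function.Surjective ψ) (M : Matrix m n A) :
    (M.map ψ).rank ≤ (M.map (algebraMap A (FractionRing A))).rank := by
  obtain ⟨B, C, h⟩ := exists_mul_mul_eq_one (M.map ψ)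
  have hB : (B.map (Function.surjInv hψ)).map ψ = B := by
    ext i j
    simp [Function.surjInv_eq hψ]
  have hC : (C.map (Function.surjInv hψ)).map ψ = C := by
    ext i j
    simp [Function.surjInv_eq hψ]
  set B' := B.map (Function.surjInv hψ)
  set C' := C.map (Function.surjInv hψ)
  have hdet : (B' * M * C').det ≠ 0 := by
    intro h0
    have h1 : ψ (B' * M * C').det = 1 := by
      rw [RingHom.map_det, RingHom.mapMatrix_apply, Matrix.map_mul, Matrix.map_mul, hB, hC, h,
        Matrix.det_one]
    rw [h0, map_zero] at h1
    exact zero_ne_one h1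
  have hdet' : ((B' * M * C').map (algebraMap A (FractionRing A))).det ≠ 0 := by
    rw [← RingHom.mapMatrix_apply, ← RingHom.map_det]
    simpa using hdet
  have := Matrix.rank_of_det_ne_zero hdet'
  rw [Fintype.card_fin] at this
  rw [← this, Matrix.map_mul, Matrix.map_mul]
  exact (Matrix.rank_mul_le_left _ _).trans (Matrix.rank_mul_le_right _ _)

/-- Here `δ` is the product of common denominators of the two factors in a certificate over the
fraction field; the certificate survives wherever `δ` does not vanish. -/
theorem exists_ne_zero_rank_le {A m n : Type*} [CommRing A] [IsDomain A]
    [Fintype m] [Fintype n] (M : Matrix m n A) :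
    ∃ δ : A, δ ≠ 0 ∧ ∀ {F : Type*} [Field F] (ψ : A →+* F), ψ δ ≠ 0 →
      (M.map (algebraMap A (FractionRing A))).rank ≤ (M.map ψ).rank := by
  obtain ⟨B, C, h⟩ := exists_mul_mul_eq_one (M.map (algebraMap A (FractionRing A)))
  obtain ⟨β, hβ⟩ := IsLocalization.exist_integer_multiples_of_finite (nonZeroDivisors A)
    (fun ij : Fin _ × m => B ij.1 ij.2)
  obtain ⟨γ, hγ⟩ := IsLocalization.exist_integer_multiples_of_finite (nonZeroDivisors A)
    (fun ij : n × Fin _ => C ij.1 ij.2)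
  choose B' hB' using fun i j => hβ (i, j)
  choose C' hC' using fun i j => hγ (i, j)
  have hB : (Matrix.of B').map (algebraMap A (FractionRing A)) = (β : A) • B := by
    ext i j
    exact hB' i j
  have hC : (Matrix.of C').map (algebraMap A (FractionRing A)) = (γ : A) • C := by
    ext i j
    exact hC' i j
  have hBC : Matrix.of B' * M * Matrix.of C' = ((β : A) * γ) • 1 := by
    have hinj := IsFractionRing.injective A (FractionRing A)
    apply Matrix.map_injective hinj
    dsimp only
    rw [Matrix.map_mul, Matrix.map_mul, hB, hC, Matrix.smul_mul, Matrix.smul_mul, Matrix.mul_smul,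
      h, smul_smul]
    ext i j
    simp only [Matrix.smul_apply, Matrix.map_apply, Matrix.one_apply, smul_eq_mul]
    split_ifs <;> simp [Algebra.smul_def]
  refine ⟨β * γ, mul_ne_zero (nonZeroDivisors.ne_zero β.2) (nonZeroDivisors.ne_zero γ.2),
    fun ψ hψ => ?_⟩
  have := le_rank_of_mul_mul_eq_smul_one (M := M.map ψ) (B := (Matrix.of B').map ψ)
    (C := (Matrix.of C').map ψ) hψ (by
      rw [← Matrix.map_mul, ← Matrix.map_mul, hBC]
      ext i j
      by_cases hij : i = j <;> simp [hij])
  simpa using this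

end MatrixRank

/-! ### The Poisson matrix, stabilizers and the index. -/

section Poisson

theorem symDerivation_ext {K M N : Type*} [CommRing K] [AddCommGroup M] [Module K M]
    [AddCommGroup N] [Module K N] [Module (SymmetricAlgebra K M) N]
    {D₁ D₂ : Derivation K (SymmetricAlgebra K M) N}
    (h : ∀ m, D₁ (SymmetricAlgebra.ι K M m) = D₂ (SymmetricAlgebra.ι K M m)) : D₁ = D₂ := by
  ext p
  induction p using SymmetricAlgebra.induction with
  | algebraMap r => simp
  | ι m => exact h m
  | mul a b ha hb => simp [ha, hb]
  | add a b ha hb => simp [ha, hb]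

theorem derivation_sum_apply {K A N ι : Type*} [CommRing K] [CommRing A] [Algebra K A]
    [AddCommGroup N] [Module K N] [Module A N] (s : Finset ι) (D : ι → Derivation K A N) (a : A) :
    (∑ i ∈ s, D i) a = ∑ i ∈ s, D i a := by
  have h := map_sum (Derivation.coeFnAddMonoidHom (R := K) (A := A) (M := N)) D s
  have h' := congrFun h a
  rw [Finset.sum_apply] at h'
  exact h'

variable {K g ι : Type*} [Field K] [LieRing g] [LieAlgebra K g] [Fintype ι]

@[simp]
theorem evalAt_ι (x : Module.Dual K g) (v : g) :
    evalAt K x (SymmetricAlgebra.ι K g v) = x v := by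
  simp [evalAt]

theorem evalAt_surjective (x : Module.Dual K g) : Function.Surjective (evalAt K x).toRingHom :=
  fun c => ⟨algebraMap K _ c, (evalAt K x).commutes c⟩

theorem mem_stabilizer {x : Module.Dual K g} {v : g} :
    v ∈ stabilizer K x ↔ ∀ w, x ⁅v, w⁆ = 0 := by
  change ⁅v, x⁆ = 0 ↔ _
  rw [LinearMap.ext_iff]
  simp

theorem exists_evalAt_ne_zero [Infinite K] {p : SymmetricAlgebra K g} (hp : p ≠ 0) :
    ∃ x, evalAt K x p ≠ 0 := by
  by_contra! h
  let b := Module.Basis.ofVectorSpace K g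
  apply hp
  apply (SymmetricAlgebra.equivMvPolynomial b).injective
  rw [map_zero]
  apply MvPolynomial.funext
  intro y
  rw [map_zero]
  have h1 : (MvPolynomial.aeval y).comp (SymmetricAlgebra.equivMvPolynomial b).toAlgHom =
      evalAt K (b.constr K y) := by
    apply SymmetricAlgebra.algHom_ext
    apply b.ext
    intro i
    simp
  have h2 := congrArg (fun φ : SymmetricAlgebra K g →ₐ[K] K => φ p) h1
  simp only [h] at h2
  exact h2

variable (b : Module.Basis ι K g)

/-- The matrix of the Poisson bracket of `S(g)` in the coordinates given by a basis of `g`. -/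
def poissonMatrix : Matrix ι ι (SymmetricAlgebra K g) :=
  Matrix.of fun i j => SymmetricAlgebra.ι K g ⁅b i, b j⁆

/-- The rank of the Poisson bracket over `Frac S(g)`. -/
def genericRank : ℕ :=
  ((poissonMatrix b).map (algebraMap (SymmetricAlgebra K g)
    (FractionRing (SymmetricAlgebra K g)))).rank

/-- Rank-nullity for `v ↦ (x [v, b j])_j`, whose kernel is the stabilizer and whose matrix is the
transpose of the Poisson matrix at `x`. -/
theorem finrank_stabilizer_add_rank (x : Module.Dual K g) :
    Module.finrank K (stabilizer K x) + ((poissonMatrix b).map (evalAt K x).toRingHom).rank =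
      Fintype.card ι := by
  classical
  have := Module.Finite.of_basis b
  set A := (poissonMatrix b).map (evalAt K x).toRingHom
  let φ : g →ₗ[K] (ι → K) := A.transpose.mulVecLin ∘ₗ b.equivFun.toLinearMap
  have hφ : ∀ v j, φ v j = x ⁅v, b j⁆ := fun v j => by
    conv_rhs => rw [← b.sum_equivFun v]
    rw [sum_lie, map_sum]
    change ∑ i, A i j * b.equivFun v i = _
    refine Finset.sum_congr rfl fun i _ => ?_
    simp [A, poissonMatrix, mul_comm]
  have hker : LinearMap.ker φ = stabilizer K x := by
    ext v
    rw [LinearMap.mem_ker, mem_stabilizer]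
    constructor
    · intro h w
      rw [← b.sum_equivFun w]
      simp only [lie_sum, lie_smul, map_sum, map_smul, ← hφ, h]
      simp
    · intro h
      ext j
      rw [hφ, h]
      rfl
  have hrange : Module.finrank K (LinearMap.range φ) = A.rank := by
    rw [LinearMap.range_comp_of_range_eq_top _ (LinearEquiv.range _), ← A.rank_transpose]
    rfl
  rw [← hker, ← hrange, add_comm, LinearMap.finrank_range_add_finrank_ker,
    Module.finrank_eq_card_basis b]

/-- A point `x` attaining the index gives `≥`, as specialization does not raise the rank; a point
`y` where `δ` does not vanish gives `≤`. -/
theorem index_add_genericRank [Infinite K] :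
    index K g + genericRank b = Fintype.card ι := by
  obtain ⟨x, hx⟩ : index K g ∈ Set.range fun x : Module.Dual K g =>
      Module.finrank K (stabilizer K x) := Nat.sInf_mem (Set.range_nonempty _)
  dsimp only at hx
  obtain ⟨δ, hδ, h⟩ := exists_ne_zero_rank_le (poissonMatrix b)
  obtain ⟨y, hy⟩ := exists_evalAt_ne_zero hδ
  have h1 := h (evalAt K y).toRingHom hy
  have h2 := rank_map_le_rank_map_algebraMap (evalAt K x).toRingHom (evalAt_surjective x)
    (poissonMatrix b)
  have h3 := finrank_stabilizer_add_rank b x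
  have h4 := finrank_stabilizer_add_rank b y
  have h5 : index K g ≤ Module.finrank K (stabilizer K y) :=
    Nat.sInf_le (Set.mem_range_self y)
  rw [genericRank]
  omega

/-- The partial derivative on `S(g)` with respect to a coordinate of a basis of `g`. -/
def partialDeriv {ι : Type*} (b : Module.Basis ι K g) (k : ι) :
    Derivation K (SymmetricAlgebra K g) (SymmetricAlgebra K g) :=
  symDerivation (Algebra.linearMap K (SymmetricAlgebra K g) ∘ₗ b.coord k)

/-- Contracting `differential` with the `k`-th coordinate (the map `T`) is a derivation that agrees
with `partialDeriv b k` on `g`. -/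
theorem coord_differentialAt {ι : Type*} (b : Module.Basis ι K g) (x : Module.Dual K g)
    (p : SymmetricAlgebra K g) (k : ι) :
    b.coord k (differentialAt K x p) = evalAt K x (partialDeriv b k p) := by
  let T : SymmetricAlgebra K g ⊗[K] g →ₗ[SymmetricAlgebra K g] SymmetricAlgebra K g :=
    TensorProduct.AlgebraTensorModule.lift
      (LinearMap.toSpanSingleton (SymmetricAlgebra K g) (g →ₗ[K] SymmetricAlgebra K g)
        (Algebra.linearMap K (SymmetricAlgebra K g) ∘ₗ b.coord k))
  have hT : ∀ s v, T (s ⊗ₜ v) = s * algebraMap K _ (b.coord k v) := fun s v => by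
    simp [T]
  have h1 : T.compDer (differential K) = partialDeriv b k := by
    apply symDerivation_ext
    intro m
    change T (differential K _) = _
    rw [differential, symDerivation_ι, partialDeriv, symDerivation_ι]
    change T (1 ⊗ₜ m) = _
    rw [hT]
    simp
  have h2 : ∀ z : SymmetricAlgebra K g ⊗[K] g,
      b.coord k (TensorProduct.lid K g ((evalAt K x).toLinearMap.rTensor g z)) =
        evalAt K x (T z) := fun z => by
    induction z with
    | zero => simp
    | add z w hz hw => simp only [map_add, hz, hw]
    | tmul s v =>
      rw [hT, map_mul, AlgHom.commutes]
      simp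
  rw [← h1]
  exact h2 _

theorem adAction_eq_sum (v : g) (p : SymmetricAlgebra K g) :
    adAction K g v p = ∑ k, partialDeriv b k p * SymmetricAlgebra.ι K g ⁅v, b k⁆ := by
  have h : adAction K g v = ∑ k, SymmetricAlgebra.ι K g ⁅v, b k⁆ • partialDeriv b k := by
    apply symDerivation_ext
    intro m
    rw [adAction, symDerivation_ι, derivation_sum_apply]
    simp only [LinearMap.comp_apply, LieAlgebra.ad_apply, Derivation.smul_apply, partialDeriv,
      symDerivation_ι]
    conv_lhs => rw [← b.sum_repr m, lie_sum, map_sum]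
    refine Finset.sum_congr rfl fun i _ => ?_
    simp [mul_comm, Algebra.smul_def]
  rw [h, derivation_sum_apply]
  simp [mul_comm]

/-- The value of `ad w p` at `x` is `x [w, dp(x)]`. -/
theorem differentialAt_mem_stabilizer [FiniteDimensional K g] (x : Module.Dual K g)
    {p : SymmetricAlgebra K g} (hp : p ∈ invariants K g) :
    differentialAt K x p ∈ stabilizer K x := by
  let b := Module.finBasis K g
  rw [mem_stabilizer]
  intro w
  have h := congrArg (evalAt K x) (hp w)
  rw [adAction_eq_sum b, map_sum, map_zero] at h
  simp only [map_mul, evalAt_ι, ← coord_differentialAt] at h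
  rw [← lie_skew, map_neg, neg_eq_zero, ← h]
  conv_lhs => rw [← b.sum_repr (differentialAt K x p), lie_sum, map_sum]
  simp only [lie_smul, map_smul, smul_eq_mul, Module.Basis.coord_apply]

end Poisson

/-! ### Transcendence degree of `Frac S(g)` over the invariants: the lower bound. -/

section FractionField

/-- The fraction field of `S(g)`. -/
abbrev FracSym (K g : Type*) [Field K] [LieRing g] [LieAlgebra K g] : Type _ :=
  FractionRing (SymmetricAlgebra K g)

variable {K g ι : Type*} [Field K] [LieRing g] [LieAlgebra K g] (b : Module.Basis ι K g)

/-- The coordinate functions on `g*` attached to a basis of `g`, as elements of `Frac S(g)`. -/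
def fracCoord (i : ι) : FracSym K g :=
  algebraMap (SymmetricAlgebra K g) (FracSym K g) (SymmetricAlgebra.ι K g (b i))

theorem isTranscendenceBasis_fracCoord : IsTranscendenceBasis K (fracCoord b) := by
  have h1 : IsTranscendenceBasis K (MvPolynomial.X : ι → MvPolynomial ι K) :=
    IsTranscendenceBasis.mvPolynomial ι K
  have h2 := (SymmetricAlgebra.equivMvPolynomial b).symm.isTranscendenceBasis_iff.2 h1
  have : Algebra.IsAlgebraic (SymmetricAlgebra K g) (FracSym K g) :=
    IsLocalization.isAlgebraic _ (nonZeroDivisors (SymmetricAlgebra K g))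
  have h3 := h2.algebraMap_comp (A := FracSym K g)
  convert h3 using 1
  ext i
  simp [fracCoord]

theorem algebraMap_mem_adjoin_fracCoord {R : Type*} [CommRing R] [Algebra K R]
    [Algebra R (FracSym K g)] [IsScalarTower K R (FracSym K g)] (p : SymmetricAlgebra K g) :
    algebraMap (SymmetricAlgebra K g) (FracSym K g) p ∈
      Algebra.adjoin R (Set.range (fracCoord b)) := by
  induction p using SymmetricAlgebra.induction with
  | algebraMap r =>
    rw [← IsScalarTower.algebraMap_apply, IsScalarTower.algebraMap_apply K R]
    exact Subalgebra.algebraMap_mem _ _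
  | ι m =>
    induction b.mem_span m using Submodule.span_induction with
    | zero => simp
    | mem x hx =>
      obtain ⟨i, rfl⟩ := hx
      exact Algebra.subset_adjoin ⟨i, rfl⟩
    | add x y _ _ hx hy => simpa using add_mem hx hy
    | smul c x _ hx =>
      rw [map_smul, Algebra.smul_def, map_mul, ← IsScalarTower.algebraMap_apply,
        IsScalarTower.algebraMap_apply K R]
      exact mul_mem (Subalgebra.algebraMap_mem _ _) hx
  | mul a b ha hb => simpa using mul_mem ha hb
  | add a b ha hb => simpa using add_mem ha hb

theorem isAlgebraic_adjoin_fracCoord (R : Type*) [Field R] [Algebra K R]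
    [Algebra R (FracSym K g)] [IsScalarTower K R (FracSym K g)] :
    Algebra.IsAlgebraic (Algebra.adjoin R (Set.range (fracCoord b))) (FracSym K g) := by
  refine ⟨fun a => ?_⟩
  obtain ⟨p, q, hq, rfl⟩ := IsFractionRing.div_surjective (A := SymmetricAlgebra K g) a
  rw [div_eq_mul_inv]
  have h : ∀ p, _root_.IsAlgebraic (Algebra.adjoin R (Set.range (fracCoord b)))
      (algebraMap (SymmetricAlgebra K g) (FracSym K g) p) := fun p =>
    isAlgebraic_algebraMap (⟨_, algebraMap_mem_adjoin_fracCoord b p⟩ :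
      Algebra.adjoin R (Set.range (fracCoord b)))
  exact (h p).mul (h q).inv

/-- The derivation of `Frac S(g)` given by the adjoint action. -/
def fracAd (v : g) : Derivation K (FracSym K g) (FracSym K g) := fracDerivation (adAction K g v)

theorem fracAd_fracCoord (i j : ι) : fracAd (b i) (fracCoord b j) =
    algebraMap (SymmetricAlgebra K g) (FracSym K g) (poissonMatrix b i j) := by
  rw [fracAd, fracCoord, fracDerivation_algebraMap, adAction, symDerivation_ι]
  rfl

theorem fracAd_algebraMap (v : g) (p : SymmetricAlgebra K g) :
    fracAd v (algebraMap _ (FracSym K g) p) = algebraMap _ (FracSym K g) (adAction K g v p) :=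
  fracDerivation_algebraMap _ _

theorem mem_invariantField {f : FracSym K g} :
    f ∈ invariantField K g ↔ ∀ v : g, fracAd v f = 0 := Iff.rfl

theorem mem_invariants {p : SymmetricAlgebra K g} :
    p ∈ invariants K g ↔ ∀ v : g, adAction K g v p = 0 := Iff.rfl

theorem algebraMap_mem_invariantField_iff {p : SymmetricAlgebra K g} :
    algebraMap _ (FracSym K g) p ∈ invariantField K g ↔ p ∈ invariants K g := by
  simp only [mem_invariantField, mem_invariants, fracAd_algebraMap,
    FaithfulSMul.algebraMap_eq_zero_iff]

/-- The derivation `D a = ∑ a i • ad (b i)` kills the invariants, so it vanishes as soon as it kills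
`y`. Thus `a ↦ D a (y ·)` has kernel inside that of `a ↦ D a (coordinates)`, a map of rank
`genericRank b`. -/
theorem genericRank_le_card [CharZero K] [Fintype ι] {t : Type*} [Fintype t]
    {y : t → FracSym K g} (hy : IsTranscendenceBasis (invariantField K g) y) :
    genericRank b ≤ Fintype.card t := by
  classical
  let D : (ι → FracSym K g) → Derivation K (FracSym K g) (FracSym K g) :=
    fun a => ∑ i, a i • fracAd (b i)
  have hD : ∀ a f, D a f = ∑ i, a i * fracAd (b i) f := fun a f => by
    simp [D, derivation_sum_apply]
  let ψ : (ι → FracSym K g) →ₗ[FracSym K g] (t → FracSym K g) :=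
    { toFun := fun a τ => D a (y τ)
      map_add' := fun a a' => by
        ext τ
        simp [hD, add_mul, Finset.sum_add_distrib]
      map_smul' := fun c a => by
        ext τ
        simp [hD, Finset.mul_sum, mul_assoc] }
  let P := (poissonMatrix b).map (algebraMap (SymmetricAlgebra K g) (FracSym K g))
  let φ := P.transpose.mulVecLin
  have hφ : ∀ a j, φ a j = D a (fracCoord b j) := fun a j => by
    rw [hD]
    change ∑ i, P i j * a i = _
    refine Finset.sum_congr rfl fun i _ => ?_
    rw [fracAd_fracCoord, mul_comm]
    rfl
  have hker : LinearMap.ker ψ ≤ LinearMap.ker φ := by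
    intro a ha
    have hF : ∀ f ∈ invariantField K g, D a f = 0 := fun f hf => by
      rw [hD]
      exact Finset.sum_eq_zero fun i _ => by rw [mem_invariantField.1 hf, mul_zero]
    rw [LinearMap.mem_ker]
    ext j
    rw [hφ]
    have := hy.isAlgebraic
    refine derivation_eq_zero_of_isAlgebraic_adjoin (derivationOver (D a) hF)
      (s := Set.range y) ?_ (Algebra.IsAlgebraic.isAlgebraic _)
    rintro _ ⟨τ, rfl⟩
    exact congrFun ha τ
  have h1 : genericRank b = Module.finrank (FracSym K g) (LinearMap.range φ) :=
    P.rank_transpose.symm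
  have h2 := φ.finrank_range_add_finrank_ker
  have h3 := ψ.finrank_range_add_finrank_ker
  have h4 := Submodule.finrank_mono hker
  have h5 := (LinearMap.range ψ).finrank_le
  rw [Module.finrank_fintype_fun_eq_card] at h5
  omega

/-- Some of the coordinate functions form a transcendence basis of `Frac S(g)` over an intermediate
field. -/
theorem exists_isTranscendenceBasis_fracCoord (F : IntermediateField K (FracSym K g)) :
    ∃ I : Set ι, IsTranscendenceBasis F fun i : I => fracCoord b i := by
  have := isAlgebraic_adjoin_fracCoord b F
  obtain ⟨t, ht, h⟩ := exists_isTranscendenceBasis_subset (R := F) (Set.range (fracCoord b))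
  obtain ⟨I, rfl⟩ := Set.subset_range_iff_exists_image_eq.1 ht
  refine ⟨I, (isTranscendenceBasis_image ?_).2 h⟩
  exact (isTranscendenceBasis_fracCoord b).1.injective.injOn

theorem card_add_card_eq (b : Module.Basis ι K g) [Fintype ι] {F : IntermediateField K (FracSym K g)} {s t : Type*}
    [Fintype s] [Fintype t] {x : s → F} {y : t → FracSym K g} (hx : IsTranscendenceBasis K x)
    (hy : IsTranscendenceBasis F y) : Fintype.card s + Fintype.card t = Fintype.card ι := by
  have h := (hx.sumElim_comp hy).lift_cardinalMk_eq (isTranscendenceBasis_fracCoord b)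
  obtain ⟨e⟩ := Cardinal.lift_mk_eq'.1 h
  rw [← Fintype.card_congr e, Fintype.card_sum, add_comm]

end FractionField

/-! ### The Jacobian criterion, and the equivalence of conditions 2 and 3. -/

section Equivalences

variable {K g ι : Type*} [Field K] [LieRing g] [LieAlgebra K g]

/-- The inclusion of the algebra of invariants in `Frac S(g)`. -/
def invariantsToFracSym (K g : Type*) [Field K] [LieRing g] [LieAlgebra K g] :
    invariants K g →ₐ[K] FracSym K g :=
  (IsScalarTower.toAlgHom K (SymmetricAlgebra K g) (FracSym K g)).comp (invariants K g).val

theorem invariantsToFracSym_injective : Function.Injective (invariantsToFracSym K g) :=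
  (IsFractionRing.injective (SymmetricAlgebra K g) (FracSym K g)).comp Subtype.val_injective

/-- The Jacobian matrix of a family of elements of `S(g)`. -/
def jacobian {κ : Type*} (b : Module.Basis ι K g) (p : κ → SymmetricAlgebra K g) :
    Matrix ι κ (SymmetricAlgebra K g) :=
  Matrix.of fun k i => partialDeriv b k (p i)

theorem derivation_algebraMap_eq_sum [Fintype ι] (b : Module.Basis ι K g)
    (D : Derivation K (FracSym K g) (FracSym K g)) (p : SymmetricAlgebra K g) :
    D (algebraMap _ (FracSym K g) p) =
      ∑ k, D (fracCoord b k) * algebraMap _ (FracSym K g) (partialDeriv b k p) := by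
  let D₁ : Derivation K (SymmetricAlgebra K g) (FracSym K g) := D.compAlgebraMap _
  let D₂ : Derivation K (SymmetricAlgebra K g) (FracSym K g) :=
    ∑ k, D (fracCoord b k) •
      ((Algebra.linearMap (SymmetricAlgebra K g) (FracSym K g)).compDer (partialDeriv b k))
  have h : D₁ = D₂ := by
    apply symDerivation_ext
    intro m
    have h1 : D₁ (SymmetricAlgebra.ι K g m) = D (algebraMap _ _ (SymmetricAlgebra.ι K g m)) := rfl
    rw [h1, derivation_sum_apply]
    conv_lhs => rw [← b.sum_repr m, map_sum, map_sum, map_sum]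
    refine Finset.sum_congr rfl fun i _ => ?_
    have h2 : partialDeriv b i (SymmetricAlgebra.ι K g m) = algebraMap K _ (b.repr m i) := by
      simp [partialDeriv]
    change _ = D (fracCoord b i) * algebraMap (SymmetricAlgebra K g) (FracSym K g)
      (partialDeriv b i (SymmetricAlgebra.ι K g m))
    rw [h2, map_smul, Algebra.smul_def, map_mul, ← IsScalarTower.algebraMap_apply,
      ← Algebra.smul_def, D.map_smul, Algebra.smul_def, mul_comm]
    rfl
  have h3 := congrArg (fun D : Derivation K (SymmetricAlgebra K g) (FracSym K g) => D p) h
  rw [derivation_sum_apply] at h3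
  exact h3

/-- There are derivations of `Frac S(g)` dual to `p`; by the chain rule their values on the
coordinates form a left inverse of the Jacobian matrix. -/
theorem card_le_rank_jacobian [CharZero K] [Fintype ι] {κ : Type*} [Fintype κ]
    (b : Module.Basis ι K g) {p : κ → SymmetricAlgebra K g} (hp : AlgebraicIndependent K p) :
    Fintype.card κ ≤ ((jacobian b p).map (algebraMap _ (FracSym K g))).rank := by
  classical
  have hv : AlgebraicIndependent K fun i => algebraMap _ (FracSym K g) (p i) :=
    ((IsScalarTower.toAlgHom K (SymmetricAlgebra K g) (FracSym K g)).algebraicIndependent_iff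
      (IsFractionRing.injective (SymmetricAlgebra K g) (FracSym K g))).2 hp
  choose D hD using fun j : κ => exists_derivation_of_algebraicIndependent hv
    (fun i => if j = i then 1 else 0)
  have h : Matrix.of (fun j k => D j (fracCoord b k)) *
      (jacobian b p).map (algebraMap _ (FracSym K g)) = 1 := by
    ext j i
    rw [Matrix.mul_apply, Matrix.one_apply, ← hD, derivation_algebraMap_eq_sum b]
    rfl
  have h1 := Matrix.rank_one (R := FracSym K g) (n := κ)
  rw [← h1, ← h]
  exact Matrix.rank_mul_le_right _ _

/-- A left inverse `B` of the Jacobian matrix gives derivations `∑ B j k • ∂ k` dual to `p`. -/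
theorem algebraicIndependent_of_card_le_rank_jacobian [CharZero K] [Fintype ι] {κ : Type*}
    [Fintype κ] (b : Module.Basis ι K g) {p : κ → SymmetricAlgebra K g}
    (hp : Fintype.card κ ≤ ((jacobian b p).map (algebraMap _ (FracSym K g))).rank) :
    AlgebraicIndependent K p := by
  classical
  obtain ⟨B, hB⟩ := exists_mul_eq_one_of_rank_eq_card
    (le_antisymm (Matrix.rank_le_card_width _) hp)
  refine ((IsScalarTower.toAlgHom K (SymmetricAlgebra K g) (FracSym K g)).algebraicIndependent_iff
    (IsFractionRing.injective (SymmetricAlgebra K g) (FracSym K g))).1 ?_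
  refine algebraicIndependent_of_derivations _
    (fun j => ∑ k, B j k • fracDerivation (partialDeriv b k)) fun j i => ?_
  have h := congrFun (congrFun hB j) i
  rw [Matrix.mul_apply, Matrix.one_apply] at h
  rw [derivation_sum_apply, ← h]
  refine Finset.sum_congr rfl fun k _ => ?_
  exact congrArg (B j k * ·) (fracDerivation_algebraMap _ _)

theorem rank_jacobian_evalAt [Fintype ι] {κ : Type*} [Fintype κ] (b : Module.Basis ι K g)
    (p : κ → SymmetricAlgebra K g) (x : Module.Dual K g) :
    ((jacobian b p).map (evalAt K x).toRingHom).rank =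
      Module.finrank K (Submodule.span K (Set.range fun i => differentialAt K x (p i))) := by
  rw [Matrix.rank_eq_finrank_span_cols, ← LinearEquiv.finrank_map_eq b.equivFun,
    Submodule.map_span, ← Set.range_comp]
  have h : ((jacobian b p).map (evalAt K x).toRingHom).col =
      b.equivFun ∘ fun i => differentialAt K x (p i) := by
    ext i k
    exact (coord_differentialAt b x (p i) k).symm
  rw [h]
  rfl

/-- The differential at a point, as a linear map. -/
def differentialAtLinear (x : Module.Dual K g) : SymmetricAlgebra K g →ₗ[K] g :=
  (TensorProduct.lid K g).toLinearMap ∘ₗ (evalAt K x).toLinearMap.rTensor g ∘ₗ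
    (differential K : Derivation K (SymmetricAlgebra K g) (SymmetricAlgebra K g ⊗[K] g)).toLinearMap

/-- Exhibits the set of differentials as a subspace, so that an inclusion into it can be checked on
a spanning family. -/
theorem differentialAt_image_invariants (x : Module.Dual K g) :
    differentialAt K x '' (invariants K g : Set (SymmetricAlgebra K g)) =
      ((Subalgebra.toSubmodule (invariants K g)).map (differentialAtLinear x) : Submodule K g) :=
  rfl

variable [FiniteDimensional K g] [CharZero K]

/-- Where `δ * δ'` does not vanish, the Poisson and Jacobian matrices have at least their generic
ranks. There `dim g(x) ≤ ind g`, while the `dp i(x)` span a subspace of `g(x)` of dimension at least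
`ind g`. -/
theorem exists_zariskiOpen_of_algebraicIndependent {p : Fin (index K g) → invariants K g}
    (hp : AlgebraicIndependent K p) :
    ∃ U : Set (Module.Dual K g), IsZariskiOpen K U ∧ U.Nonempty ∧
      ∀ x ∈ U, (stabilizer K x : Set g) =
        differentialAt K x '' (invariants K g : Set (SymmetricAlgebra K g)) := by
  let b := Module.finBasis K g
  have hp' : AlgebraicIndependent K fun i => (p i).1 :=
    ((invariants K g).val.algebraicIndependent_iff Subtype.val_injective).2 hp
  obtain ⟨δ, hδ, h⟩ := exists_ne_zero_rank_le (poissonMatrix b)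
  obtain ⟨δ', hδ', h'⟩ := exists_ne_zero_rank_le (jacobian b fun i => (p i).1)
  refine ⟨{x | evalAt K x (δ * δ') ≠ 0}, ⟨{δ * δ'}, by simp⟩,
    exists_evalAt_ne_zero (mul_ne_zero hδ hδ'), fun x hx => ?_⟩
  rw [Set.mem_ofPred_eq, map_mul, mul_ne_zero_iff] at hx
  have h1 := h (evalAt K x).toRingHom hx.1
  have h2 := h' (evalAt K x).toRingHom hx.2
  have h3 := card_le_rank_jacobian b hp'
  rw [rank_jacobian_evalAt] at h2
  have h6 := h3.trans h2
  rw [Fintype.card_fin] at h6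
  have h4 := finrank_stabilizer_add_rank b x
  have h5 := index_add_genericRank b
  rw [genericRank] at h5
  have hle : Submodule.span K (Set.range fun i => differentialAt K x (p i).1) ≤
      stabilizer K x := by
    rw [Submodule.span_le]
    rintro _ ⟨i, rfl⟩
    exact differentialAt_mem_stabilizer x (p i).2
  have heq := Submodule.eq_of_le_of_finrank_le hle (by omega)
  rw [differentialAt_image_invariants]
  apply Set.Subset.antisymm
  · rw [← heq, SetLike.coe_subset_coe, Submodule.span_le]
    rintro _ ⟨i, rfl⟩
    exact ⟨_, (p i).2, rfl⟩
  · rintro _ ⟨q, hq, rfl⟩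
    exact differentialAt_mem_stabilizer x hq

/-- A single point suffices: invariants whose differentials at `x` are basis vectors of `g(x)` have
independent Jacobian columns at `x`, hence generically. Since `dim g(x)` may exceed the index, only
the first `ind g` of them are kept. -/
theorem exists_algebraicIndependent_of_stabilizer_eq (x : Module.Dual K g)
    (hx : (stabilizer K x : Set g) =
        differentialAt K x '' (invariants K g : Set (SymmetricAlgebra K g))) :
    ∃ p : Fin (index K g) → invariants K g, AlgebraicIndependent K p := by
  let b := Module.finBasis K g
  have hle : index K g ≤ Module.finrank K (stabilizer K x) := Nat.sInf_le (Set.mem_range_self x)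
  let w := Module.finBasis K (stabilizer K x)
  have hw : ∀ i, ∃ p : invariants K g, differentialAt K x p.1 = (w i).1 := fun i => by
    have h : (w i).1 ∈ (stabilizer K x : Set g) := (w i).2
    rw [hx] at h
    obtain ⟨p, hp, h⟩ := h
    exact ⟨⟨p, hp⟩, h⟩
  choose p hp using hw
  refine ⟨fun i => p (Fin.castLE hle i), ?_⟩
  refine ((invariants K g).val.algebraicIndependent_iff Subtype.val_injective).1
    (algebraicIndependent_of_card_le_rank_jacobian b ?_)
  refine le_trans (le_of_eq ?_) (rank_map_le_rank_map_algebraMap (evalAt K x).toRingHom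
    (evalAt_surjective x) _)
  rw [rank_jacobian_evalAt]
  symm
  apply finrank_span_eq_card
  have h1 : LinearIndependent K fun i => (w i).1 :=
    w.linearIndependent.map' (stabilizer K x).subtype (Submodule.ker_subtype _)
  convert h1.comp _ (Fin.castLE_injective hle) using 1
  ext i
  exact hp _

end Equivalences

/-! ### The field of invariants: 2 → 1, and 1 → 2 granted the upper bound on ranks. -/

section FieldOfInvariants

variable {K g ι : Type*} [Field K] [LieRing g] [LieAlgebra K g]

theorem isIntegrallyClosed_symmetricAlgebra :
    IsIntegrallyClosed (SymmetricAlgebra K g) :=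
  IsIntegrallyClosed.of_equiv
    (SymmetricAlgebra.equivMvPolynomial (Module.Basis.ofVectorSpace K g)).symm.toRingEquiv

theorem fracInvariants_le_invariantField : fracInvariants K g ≤ invariantField K g := by
  rw [fracInvariants, IntermediateField.adjoin_le_iff]
  rintro _ ⟨p, hp, rfl⟩
  exact algebraMap_mem_invariantField_iff.2 hp

/-- No condition `q ≠ 0` is needed: division by zero gives `0`. -/
theorem mem_fracInvariants_iff {f : FracSym K g} : f ∈ fracInvariants K g ↔
    ∃ p q : invariants K g, f = invariantsToFracSym K g p / invariantsToFracSym K g q := by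
  have h : algebraMap (SymmetricAlgebra K g) (FracSym K g) ''
      (invariants K g : Set (SymmetricAlgebra K g)) = (invariantsToFracSym K g).range := by
    ext z
    constructor
    · rintro ⟨p, hp, rfl⟩
      exact ⟨⟨p, hp⟩, rfl⟩
    · rintro ⟨p, rfl⟩
      exact ⟨p.1, p.2, rfl⟩
  rw [fracInvariants, h, IntermediateField.mem_adjoin_iff_div, Algebra.adjoin_eq]
  constructor
  · rintro ⟨_, ⟨p, rfl⟩, _, ⟨q, rfl⟩, rfl⟩
    exact ⟨p, q, rfl⟩
  · rintro ⟨p, q, rfl⟩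
    exact ⟨_, ⟨p, rfl⟩, _, ⟨q, rfl⟩, rfl⟩

/-- An element of the field of invariants that is algebraic over the algebra of invariants is a
quotient of invariants. -/
theorem mem_fracInvariants_of_isAlgebraic {f : FracSym K g} (hf : f ∈ invariantField K g)
    (halg : _root_.IsAlgebraic (invariants K g) f) : f ∈ fracInvariants K g := by
  have := isIntegrallyClosed_symmetricAlgebra (K := K) (g := g)
  -- For a nonzero invariant `c` the multiple `c • f` is integral over the invariants, hence lies in
  -- the integrally closed ring `S(g)`; being a product of invariants, it is invariant.
  obtain ⟨c, hc, hint⟩ := halg.exists_integral_multiple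
  have hint' : IsIntegral (SymmetricAlgebra K g) (c • f) := hint.tower_top
  obtain ⟨s, hs⟩ := IsIntegrallyClosed.isIntegral_iff.1 hint'
  have hcs : c • f = invariantsToFracSym K g c * f := Algebra.smul_def c f
  have hsinv : s ∈ invariants K g := by
    rw [← algebraMap_mem_invariantField_iff, hs, hcs]
    exact mul_mem (algebraMap_mem_invariantField_iff.2 c.2) hf
  have hc0 : invariantsToFracSym K g c ≠ 0 := by
    rw [Ne, ← map_zero (invariantsToFracSym K g)]
    exact fun h => hc (invariantsToFracSym_injective h)
  refine mem_fracInvariants_iff.2 ⟨⟨s, hsinv⟩, c, ?_⟩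
  rw [eq_div_iff hc0, mul_comm, ← hcs, ← hs]
  rfl

variable [FiniteDimensional K g] [CharZero K]

/-- By additivity of transcendence degrees, `|s| = dim g - |I|`, and `|I| ≥ genericRank b`. -/
theorem finite_and_card_le_index {s : Type*} {x : s → invariantField K g}
    (hx : IsTranscendenceBasis K x) : Finite s ∧ Nat.card s ≤ index K g := by
  classical
  let b := Module.finBasis K g
  obtain ⟨I, hI⟩ := exists_isTranscendenceBasis_fracCoord b (invariantField K g)
  have : Finite s := by
    obtain ⟨e⟩ := Cardinal.lift_mk_eq'.1
      ((hx.sumElim_comp hI).lift_cardinalMk_eq (isTranscendenceBasis_fracCoord b))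
    exact Finite.of_injective (fun i => e (Sum.inr i)) (e.injective.comp Sum.inr_injective)
  refine ⟨this, ?_⟩
  have := Fintype.ofFinite s
  have h1 := card_add_card_eq b hx hI
  have h2 := genericRank_le_card b hI
  have h3 := index_add_genericRank b
  rw [Nat.card_eq_fintype_card]
  omega

theorem isTranscendenceBasis_of_algebraicIndependent {v : Fin (index K g) → invariantField K g}
    (hv : AlgebraicIndependent K v) : IsTranscendenceBasis K v := by
  obtain ⟨t, hst, ht⟩ := exists_isTranscendenceBasis_superset hv.to_subtype_range
  obtain ⟨hfin, hcard⟩ := finite_and_card_le_index ht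
  have h : Set.range v = t := by
    apply Set.eq_of_subset_of_ncard_le hst _ (Set.toFinite t)
    rw [← Nat.card_coe_set_eq, ← Nat.card_coe_set_eq,
      Nat.card_range_of_injective hv.injective, Nat.card_fin]
    exact hcard
  subst h
  exact ht.of_subtype_range hv.injective

theorem invariantField_eq_of_algebraicIndependent {p : Fin (index K g) → invariants K g}
    (hp : AlgebraicIndependent K p) : invariantField K g = fracInvariants K g := by
  refine le_antisymm (fun f hf => ?_) fracInvariants_le_invariantField
  refine mem_fracInvariants_of_isAlgebraic hf ?_
  let v : Fin (index K g) → invariantField K g := fun i =>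
    ⟨invariantsToFracSym K g (p i), algebraMap_mem_invariantField_iff.2 (p i).2⟩
  have hv : AlgebraicIndependent K v := by
    refine ((invariantField K g).val.algebraicIndependent_iff
      (invariantField K g).val.injective).1 ?_
    exact ((invariantsToFracSym K g).algebraicIndependent_iff invariantsToFracSym_injective).2 hp
  have halg := (isTranscendenceBasis_of_algebraicIndependent hv).isAlgebraic.isAlgebraic
    (⟨f, hf⟩ : invariantField K g)
  -- Algebraicity over `K[v]`, inside the field of invariants, is carried to the algebra of
  -- invariants by `v i ↦ p i`.
  let φ : Algebra.adjoin K (Set.range v) →ₐ[K] invariants K g :=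
    (MvPolynomial.aeval p).comp hv.aevalEquiv.symm.toAlgHom
  refine halg.ringHom_of_comp_eq φ (invariantField K g).val
    (show Function.Injective (MvPolynomial.aeval p ∘ hv.aevalEquiv.symm) from
      Function.Injective.comp hp hv.aevalEquiv.symm.injective) ?_
  ext z
  obtain ⟨q, rfl⟩ := hv.aevalEquiv.surjective z
  have h : (invariantsToFracSym K g).comp (MvPolynomial.aeval p) =
      (invariantField K g).val.comp (MvPolynomial.aeval v) := by
    ext i
    simp [v]
  have h' := congrArg (fun φ : MvPolynomial (Fin (index K g)) K →ₐ[K] FracSym K g => φ q) h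
  have h1 : φ (hv.aevalEquiv q) = MvPolynomial.aeval p q :=
    congrArg (MvPolynomial.aeval p) (hv.aevalEquiv.symm_apply_apply q)
  have h2 : algebraMap _ (invariantField K g) (hv.aevalEquiv q) = MvPolynomial.aeval v q := by
    simp
  change invariantsToFracSym K g (φ (hv.aevalEquiv q)) =
    (invariantField K g).val (algebraMap _ (invariantField K g) (hv.aevalEquiv q))
  rw [h1, h2]
  exact h'

/-- If the field of invariants has the expected transcendence degree and is the fraction field of
the algebra of invariants, the latter contains sufficiently many independent elements. -/
theorem exists_algebraicIndependent_of_invariantField_eq (b : Module.Basis ι K g) [Fintype ι]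
    (hrank : ∀ I : Set ι, IsTranscendenceBasis (invariantField K g) (fun i : I => fracCoord b i) →
      Nat.card I ≤ genericRank b)
    (heq : invariantField K g = fracInvariants K g) :
    ∃ p : Fin (index K g) → invariants K g, AlgebraicIndependent K p := by
  classical
  let j : invariants K g → invariantField K g := fun p =>
    ⟨invariantsToFracSym K g p, algebraMap_mem_invariantField_iff.2 p.2⟩
  have halg : Algebra.IsAlgebraic (Algebra.adjoin K (Set.range j)) (invariantField K g) := by
    refine ⟨fun f => ?_⟩
    obtain ⟨p, q, hpq⟩ := mem_fracInvariants_iff.1 (heq.le f.2)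
    have hf : f = j p * (j q)⁻¹ := by
      ext
      rw [hpq, div_eq_mul_inv]
      rfl
    have hj : ∀ p, _root_.IsAlgebraic (Algebra.adjoin K (Set.range j)) (j p) := fun p =>
      isAlgebraic_algebraMap (⟨j p, Algebra.subset_adjoin ⟨p, rfl⟩⟩ :
        Algebra.adjoin K (Set.range j))
    rw [hf]
    exact (hj p).mul (hj q).inv
  have : FaithfulSMul K (invariantField K g) :=
    (faithfulSMul_iff_algebraMap_injective K _).2 (algebraMap K (invariantField K g)).injective
  -- The invariants generate the field, so they contain a transcendence basis `t` of it; then `|t| =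
  -- dim g - |I|` is at least `ind g` by `hrank`.
  obtain ⟨t, ht, htb⟩ := exists_isTranscendenceBasis_subset (R := K) (Set.range j)
  obtain ⟨I, hI⟩ := exists_isTranscendenceBasis_fracCoord b (invariantField K g)
  have : Finite t := (finite_and_card_le_index htb).1
  have := Fintype.ofFinite t
  have h1 : Nat.card t + Nat.card I = Fintype.card ι := by
    have h := card_add_card_eq b htb hI
    simp only [← Nat.card_eq_fintype_card] at h ⊢
    exact h
  have h2 := hrank I hI
  have h3 := index_add_genericRank b
  have hle : Fintype.card (Fin (index K g)) ≤ Fintype.card t := by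
    rw [Fintype.card_fin, ← Nat.card_eq_fintype_card]
    omega
  obtain ⟨e⟩ := Function.Embedding.nonempty_of_card_le hle
  choose p hp using fun z : t => ht z.2
  refine ⟨fun i => p (e i), ?_⟩
  refine ((invariantsToFracSym K g).algebraicIndependent_iff invariantsToFracSym_injective).1 ?_
  have h4 := ((invariantField K g).val.algebraicIndependent_iff
    (invariantField K g).val.injective).2 (htb.1.comp e e.injective)
  convert h4 using 1
  ext i
  exact congrArg Subtype.val (hp (e i))

end FieldOfInvariants

/-! ### Points of an algebraic group with values in `K`-algebras. -/

section PointsOfGroups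

theorem fst_aeval_inl_add_inr {K A σ : Type*} [CommRing K] [CommRing A] [Algebra K A]
    (p : MvPolynomial σ K) (a y : σ → A) :
    (MvPolynomial.aeval (fun i => TrivSqZeroExt.inl (a i) + TrivSqZeroExt.inr (y i) :
      σ → TrivSqZeroExt A A) p).fst = MvPolynomial.aeval a p := by
  have h : (TrivSqZeroExt.fstHom K A A).comp
      (MvPolynomial.aeval (fun i => TrivSqZeroExt.inl (a i) + TrivSqZeroExt.inr (y i) :
        σ → TrivSqZeroExt A A)) = MvPolynomial.aeval a := by
    ext i
    simp
  exact congrArg (fun φ : MvPolynomial σ K →ₐ[K] A => φ p) h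

theorem snd_aeval_inl_add_inr {K A σ : Type*} [CommRing K] [CommRing A] [Algebra K A] [Fintype σ]
    (p : MvPolynomial σ K) (a y : σ → A) :
    (MvPolynomial.aeval (fun i => TrivSqZeroExt.inl (a i) + TrivSqZeroExt.inr (y i) :
      σ → TrivSqZeroExt A A) p).snd =
      ∑ i, MvPolynomial.aeval a (MvPolynomial.pderiv i p) * y i := by
  classical
  induction p using MvPolynomial.induction_on with
  | C c => simp [TrivSqZeroExt.algebraMap_eq_inl']
  | add p q hp hq =>
    simp only [map_add, TrivSqZeroExt.snd_add, hp, hq, add_mul, Finset.sum_add_distrib]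
  | mul_X p j hp =>
    rw [map_mul, TrivSqZeroExt.snd_mul, hp, fst_aeval_inl_add_inr]
    simp only [MvPolynomial.aeval_X, Derivation.leibniz, MvPolynomial.pderiv_X, smul_eq_mul,
      map_add, map_mul, TrivSqZeroExt.fst_add, TrivSqZeroExt.snd_add, TrivSqZeroExt.fst_inl,
      TrivSqZeroExt.fst_inr, TrivSqZeroExt.snd_inl, TrivSqZeroExt.snd_inr, add_zero, zero_add,
      add_mul, Finset.sum_add_distrib, op_smul_eq_smul, Finset.mul_sum]
    congr 1
    · rw [Finset.sum_eq_single j]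
      · simp
      · intro i _ hi
        simp [Pi.single_eq_of_ne hi.symm]
      · simp
    · exact Finset.sum_congr rfl fun i _ => by ring

variable {K : Type*} [Field K] {n : ℕ} (G : Subgroup (GL (Fin n) K))

/-- A matrix over a `K`-algebra is a point of (the closure of) `G` if it satisfies all polynomial
equations of `G`. -/
def IsPointOf {C : Type*} [CommRing C] [Algebra K C] (M : Matrix (Fin n) (Fin n) C) : Prop :=
  ∀ p : MvPolynomial (Fin n × Fin n) K,
    (∀ a ∈ G, MvPolynomial.eval (fun ij => a.val ij.1 ij.2) p = 0) →
      MvPolynomial.aeval (fun ij => M ij.1 ij.2) p = 0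

variable {G}

/-- Expanding the coefficients of `q` in a `K`-basis of `B` writes `q` as a combination of
polynomials over `K`, each of which vanishes on `G`. -/
theorem aeval_eq_zero_of_isPointOf {B C : Type*} [CommRing B] [Algebra K B] [CommRing C]
    [Algebra K C] [Algebra B C] [IsScalarTower K B C] {q : MvPolynomial (Fin n × Fin n) B}
    (hq : ∀ a ∈ G, MvPolynomial.eval (fun ij => algebraMap K B (a.val ij.1 ij.2)) q = 0)
    {M : Matrix (Fin n) (Fin n) C} (hM : IsPointOf G M) :
    MvPolynomial.aeval (fun ij => M ij.1 ij.2) q = 0 := by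
  classical
  let β := Module.Basis.ofVectorSpace K B
  obtain ⟨t, rfl⟩ := (MvPolynomial.algebraTensorAlgEquiv (σ := Fin n × Fin n) K B).surjective q
  obtain ⟨c, rfl⟩ := TensorProduct.eq_repr_basis_left β t
  rw [Finsupp.sum, map_sum] at hq ⊢
  simp only [MvPolynomial.algebraTensorAlgEquiv_tmul, map_sum, MvPolynomial.smul_eval,
    MvPolynomial.eval_map] at hq ⊢
  have hc : ∀ k ∈ c.support, ∀ a ∈ G,
      MvPolynomial.eval (fun ij => a.val ij.1 ij.2) (c k) = 0 := by
    intro k hk a ha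
    have h1 := hq a ha
    have h2 : ∀ r : MvPolynomial (Fin n × Fin n) K, MvPolynomial.eval₂ (algebraMap K B)
        (fun ij => algebraMap K B (a.val ij.1 ij.2)) r =
        algebraMap K B (MvPolynomial.eval (fun ij => a.val ij.1 ij.2) r) :=
      fun r => MvPolynomial.aeval_algebraMap_apply B (fun ij : Fin n × Fin n => a.val ij.1 ij.2) r
    simp only [h2, mul_comm (β _), ← Algebra.smul_def] at h1
    exact linearIndependent_iff'.1 β.linearIndependent c.support _ h1 k hk
  refine Finset.sum_eq_zero fun k hk => ?_
  rw [map_smul, MvPolynomial.aeval_map_algebraMap, hM _ (hc k hk), smul_zero]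

theorem IsPointOf.map {C C' : Type*} [CommRing C] [Algebra K C] [CommRing C'] [Algebra K C']
    {M : Matrix (Fin n) (Fin n) C} (hM : IsPointOf G M) (f : C →ₐ[K] C') :
    IsPointOf G (M.map f) := by
  intro p hp
  have h := congrArg f (hM p hp)
  rw [map_zero, ← AlgHom.comp_apply, MvPolynomial.comp_aeval] at h
  exact h

theorem isPointOf_of_mem {a : GL (Fin n) K} (ha : a ∈ G) : IsPointOf G a.val := by
  intro p hp
  rw [MvPolynomial.aeval_eq_eval]
  exact hp a ha

/-- The polynomial `p(N x)` in the entries of a matrix `x`. -/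
def leftMulPoly (N : Matrix (Fin n) (Fin n) K) (p : MvPolynomial (Fin n × Fin n) K) :
    MvPolynomial (Fin n × Fin n) K :=
  MvPolynomial.aeval (fun ij => ∑ k, MvPolynomial.C (N ij.1 k) * MvPolynomial.X (k, ij.2)) p

theorem aeval_leftMulPoly {A : Type*} [CommRing A] [Algebra K A] (N : Matrix (Fin n) (Fin n) K)
    (p : MvPolynomial (Fin n × Fin n) K) (M : Matrix (Fin n) (Fin n) A) :
    MvPolynomial.aeval (fun ij => M ij.1 ij.2) (leftMulPoly N p) =
      MvPolynomial.aeval (fun ij => (N.map (algebraMap K A) * M) ij.1 ij.2) p := by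
  rw [leftMulPoly, ← AlgHom.comp_apply, MvPolynomial.comp_aeval]
  congr 2
  ext ij
  simp [Matrix.mul_apply]

/-- For `a ∈ G` the polynomial `p(a ·)` vanishes on `G`, hence at `M'`. So `p(· M')`, with
coefficients in `C`, vanishes on `G`, hence at `M`. -/
theorem IsPointOf.mul {C : Type*} [CommRing C] [Algebra K C] {M M' : Matrix (Fin n) (Fin n) C}
    (hM : IsPointOf G M) (hM' : IsPointOf G M') : IsPointOf G (M * M') := by
  intro p hp
  have hleft : ∀ a ∈ G, MvPolynomial.aeval
      (fun ij => ((a.val.map (algebraMap K C)) * M') ij.1 ij.2) p = 0 := by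
    intro a ha
    rw [← aeval_leftMulPoly]
    apply hM'
    intro a' ha'
    rw [← MvPolynomial.aeval_eq_eval]
    refine (aeval_leftMulPoly a.val p a'.val).trans ?_
    rw [MvPolynomial.aeval_eq_eval]
    exact hp (a * a') (mul_mem ha ha')
  let q : MvPolynomial (Fin n × Fin n) C := MvPolynomial.aeval
    (fun ij => ∑ k, MvPolynomial.X (ij.1, k) * MvPolynomial.C (M' k ij.2)) p
  have hq : ∀ N : Matrix (Fin n) (Fin n) C, MvPolynomial.aeval (fun ij => N ij.1 ij.2) q =
      MvPolynomial.aeval (fun ij => (N * M') ij.1 ij.2) p := fun N => by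
    change ((MvPolynomial.aeval (R := C) (fun ij => N ij.1 ij.2)).restrictScalars K) q = _
    rw [← AlgHom.comp_apply, MvPolynomial.comp_aeval]
    congr 2
    ext ij
    simp [Matrix.mul_apply]
  rw [← hq]
  refine aeval_eq_zero_of_isPointOf (fun a ha => ?_) hM
  rw [← MvPolynomial.aeval_eq_eval]
  exact (hq (a.val.map (algebraMap K C))).trans (hleft a ha)

end PointsOfGroups

/-! ### Dual numbers and tangent vectors. -/

section DualMatrices

variable {K R : Type*} [Field K] [CommRing R] [Algebra K R] {n : ℕ}

/-- The matrix `A + ε B` over the dual numbers. -/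
def dualMatrix (A B : Matrix (Fin n) (Fin n) R) : Matrix (Fin n) (Fin n) (TrivSqZeroExt R R) :=
  Matrix.of fun i j => TrivSqZeroExt.inl (A i j) + TrivSqZeroExt.inr (B i j)

theorem dualMatrix_mul (A B A' B' : Matrix (Fin n) (Fin n) R) :
    dualMatrix A B * dualMatrix A' B' = dualMatrix (A * A') (A * B' + B * A') := by
  ext i j
  · simp [dualMatrix, Matrix.mul_apply, TrivSqZeroExt.fst_sum]
  · simp [dualMatrix, Matrix.mul_apply, TrivSqZeroExt.snd_sum, Finset.sum_add_distrib, mul_comm]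

/-- First-order expansion of `p(1 + ε Y)`; its constant term vanishes because `1 ∈ G`. -/
theorem isPointOf_dualMatrix_one_iff {G : Subgroup (GL (Fin n) K)} (Y : Matrix (Fin n) (Fin n) R) :
    IsPointOf G (dualMatrix 1 Y) ↔ ∀ p : MvPolynomial (Fin n × Fin n) K,
      (∀ a ∈ G, MvPolynomial.eval (fun ij => a.val ij.1 ij.2) p = 0) →
        ∑ ij : Fin n × Fin n, algebraMap K R (MvPolynomial.eval
          (fun kl => (1 : Matrix (Fin n) (Fin n) K) kl.1 kl.2) (MvPolynomial.pderiv ij p)) *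
            Y ij.1 ij.2 = 0 := by
  have h1 : ∀ p : MvPolynomial (Fin n × Fin n) K,
      MvPolynomial.aeval (fun kl => (1 : Matrix (Fin n) (Fin n) R) kl.1 kl.2) p =
        algebraMap K R (MvPolynomial.eval
          (fun kl => (1 : Matrix (Fin n) (Fin n) K) kl.1 kl.2) p) := fun p => by
    rw [← MvPolynomial.aeval_eq_eval, ← MvPolynomial.aeval_algebraMap_apply]
    congr 2
    ext kl
    simp [Matrix.one_apply, apply_ite (algebraMap K R)]
  refine forall₂_congr fun p hp => ?_
  have hfst : (MvPolynomial.aeval (fun ij : Fin n × Fin n =>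
      dualMatrix (1 : Matrix (Fin n) (Fin n) R) Y ij.1 ij.2) p).fst = 0 := by
    refine (fst_aeval_inl_add_inr p _ _).trans ?_
    rw [h1, ← map_zero (algebraMap K R)]
    congr 1
    exact hp 1 (one_mem G)
  have hsnd : (MvPolynomial.aeval (fun ij : Fin n × Fin n =>
      dualMatrix (1 : Matrix (Fin n) (Fin n) R) Y ij.1 ij.2) p).snd = _ :=
    snd_aeval_inl_add_inr p _ _
  simp only [h1] at hsnd
  rw [← hsnd, TrivSqZeroExt.ext_iff, hfst]
  simp

theorem isPointOf_dualMatrix_one_iff_mem {G : Subgroup (GL (Fin n) K)}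
    (X : Matrix (Fin n) (Fin n) K) :
    IsPointOf G (dualMatrix 1 X) ↔ X ∈ lieAlgebraOf G :=
  isPointOf_dualMatrix_one_iff X

theorem isPointOf_dualMatrix_map {G : Subgroup (GL (Fin n) K)} {X : Matrix (Fin n) (Fin n) K}
    (hX : X ∈ lieAlgebraOf G) : IsPointOf G (dualMatrix 1 (X.map (algebraMap K R))) := by
  rw [isPointOf_dualMatrix_one_iff]
  intro p hp
  have h := congrArg (algebraMap K R) (hX p hp)
  simpa using h

theorem IsPointOf.dualMatrix_zero {G : Subgroup (GL (Fin n) K)} {M : Matrix (Fin n) (Fin n) R}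
    (hM : IsPointOf G M) : IsPointOf G (dualMatrix M 0) := by
  have h := hM.map (TrivSqZeroExt.inlAlgHom K R R)
  convert h using 1
  ext i j <;> simp [dualMatrix]

/-- The algebra morphism `r ↦ r + ε D r` carries points to points. This is what will make `γ⁻¹ D(γ)`
tangent at the identity. -/
theorem IsPointOf.dualMatrix_derivation {G : Subgroup (GL (Fin n) K)}
    {M : Matrix (Fin n) (Fin n) R} (hM : IsPointOf G M) (D : Derivation K R R) :
    IsPointOf G (dualMatrix M (M.map D)) :=
  hM.map (derivationHom D)

/-- Lie algebras of algebraic groups are stable under the adjoint action of the group. -/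
theorem conj_mem_lieAlgebraOf {G : Subgroup (GL (Fin n) K)} {X : Matrix (Fin n) (Fin n) K}
    (hX : X ∈ lieAlgebraOf G) {a : GL (Fin n) K} (ha : a ∈ G) :
    a⁻¹.val * X * a.val ∈ lieAlgebraOf G := by
  rw [← isPointOf_dualMatrix_one_iff_mem] at hX ⊢
  have h := ((isPointOf_of_mem (inv_mem ha)).dualMatrix_zero.mul hX).mul
    (isPointOf_of_mem ha).dualMatrix_zero
  rw [dualMatrix_mul, dualMatrix_mul] at h
  simpa using h

end DualMatrices

/-! ### Extension of scalars for linear maps on matrices. -/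

section LinearExtension

variable {K : Type*} [Field K] {n : ℕ}

/-- The extension of a `K`-linear map from matrices over `K` to matrices over a larger ring. -/
def matrixExtend {A : Type*} [CommRing A] [Algebra K A] (φ : Matrix (Fin n) (Fin n) K →ₗ[K] A)
    (C : Type*) [CommRing C] [Algebra A C] : Matrix (Fin n) (Fin n) C →ₗ[C] C where
  toFun M := ∑ i, ∑ j, M i j * algebraMap A C (φ (Matrix.single i j 1))
  map_add' M N := by simp [add_mul, Finset.sum_add_distrib]
  map_smul' c M := by simp [Finset.mul_sum, mul_assoc]

variable {A : Type*} [CommRing A] [Algebra K A] (φ : Matrix (Fin n) (Fin n) K →ₗ[K] A)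
  {C : Type*} [CommRing C] [Algebra A C]

theorem matrixExtend_apply (M : Matrix (Fin n) (Fin n) C) :
    matrixExtend φ C M = ∑ i, ∑ j, M i j * algebraMap A C (φ (Matrix.single i j 1)) := rfl

theorem linearMap_eq_sum_single {V : Type*} [AddCommGroup V] [Module K V]
    (φ : Matrix (Fin n) (Fin n) K →ₗ[K] V) (M : Matrix (Fin n) (Fin n) K) :
    φ M = ∑ i, ∑ j, M i j • φ (Matrix.single i j 1) := by
  conv_lhs => rw [Matrix.matrix_eq_sum_single M]
  simp only [map_sum]
  refine Finset.sum_congr rfl fun i _ => Finset.sum_congr rfl fun j _ => ?_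
  rw [← map_smul, Matrix.smul_single, smul_eq_mul, mul_one]

theorem matrixExtend_map_algebraMap [Algebra K C] [IsScalarTower K A C]
    (M : Matrix (Fin n) (Fin n) K) :
    matrixExtend φ C (M.map (algebraMap K C)) = algebraMap A C (φ M) := by
  rw [linearMap_eq_sum_single φ M, matrixExtend_apply]
  simp only [map_sum]
  refine Finset.sum_congr rfl fun i _ => Finset.sum_congr rfl fun j _ => ?_
  rw [Algebra.smul_def, map_mul, ← IsScalarTower.algebraMap_apply]
  rfl

theorem map_matrixExtend {C' : Type*} [CommRing C'] [Algebra A C'] (f : C →ₐ[A] C')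
    (M : Matrix (Fin n) (Fin n) C) :
    f (matrixExtend φ C M) = matrixExtend φ C' (M.map f) := by
  simp [matrixExtend_apply]

theorem derivation_matrixExtend (D : Derivation A C C) (M : Matrix (Fin n) (Fin n) C) :
    D (matrixExtend φ C M) = matrixExtend φ C (M.map D) := by
  simp [matrixExtend_apply, mul_comm]

theorem matrixExtend_dualMatrix (M N : Matrix (Fin n) (Fin n) C) :
    matrixExtend φ (TrivSqZeroExt C C) (dualMatrix M N) =
      TrivSqZeroExt.inl (matrixExtend φ C M) + TrivSqZeroExt.inr (matrixExtend φ C N) := by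
  ext
  · simp [matrixExtend_apply, dualMatrix, TrivSqZeroExt.fst_sum,
      TrivSqZeroExt.algebraMap_eq_inl']
  · simp [matrixExtend_apply, dualMatrix, TrivSqZeroExt.snd_sum,
      TrivSqZeroExt.algebraMap_eq_inl', mul_comm]

/-- The Lie algebra of an algebraic group, extended to a `K`-algebra `E`, is the tangent space
at the identity over `E`. -/
theorem eq_sum_of_isPointOf_dualMatrix_one {g ι : Type*} [AddCommGroup g] [Module K g] [Fintype ι]
    {G : Subgroup (GL (Fin n) K)} {ρ : g →ₗ[K] Matrix (Fin n) (Fin n) K}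
    (hρ : Set.range ρ = lieAlgebraOf G) {π : Matrix (Fin n) (Fin n) K →ₗ[K] g}
    (hπ : ∀ v, π (ρ v) = v) (b : Module.Basis ι K g) {E : Type*} [CommRing E] [Algebra K E]
    {Y : Matrix (Fin n) (Fin n) E} (hY : IsPointOf G (dualMatrix 1 Y)) :
    Y = ∑ l, matrixExtend (b.coord l ∘ₗ π) E Y • (ρ (b l)).map (algebraMap K E) := by
  rw [isPointOf_dualMatrix_one_iff] at hY
  ext i j
  -- It suffices to test against `K`-linear forms `f` on `E`. The tangent equations have
  -- coefficients in `K`, so applying `f` entrywise to `Y` gives an element of `Lie G`, that is,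
  -- some `ρ v`.
  rw [← sub_eq_zero, ← Module.forall_dual_apply_eq_zero_iff K]
  intro f
  have hf : ∀ (c : K) (e : E), f (algebraMap K E c * e) = c * f e := fun c e => by
    rw [← Algebra.smul_def, map_smul, smul_eq_mul]
  have hmem : Y.map f ∈ lieAlgebraOf G := by
    intro p hp
    have h := congrArg f (hY p hp)
    rw [map_sum, map_zero] at h
    simp only [hf] at h
    exact h
  rw [← hρ] at hmem
  obtain ⟨v, hv⟩ := hmem
  have h1 : ∀ l, f (matrixExtend (b.coord l ∘ₗ π) E Y) = b.coord l v := fun l => by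
    rw [← hπ v, hv, ← LinearMap.comp_apply, linearMap_eq_sum_single (b.coord l ∘ₗ π) (Y.map f),
      matrixExtend_apply]
    simp only [map_sum]
    refine Finset.sum_congr rfl fun i _ => Finset.sum_congr rfl fun j _ => ?_
    rw [mul_comm, hf, mul_comm]
    rfl
  have h2 := congrFun (congrFun hv i) j
  rw [map_sub, sub_eq_zero]
  change f (Y i j) = _
  rw [← Matrix.map_apply (M := Y) (f := f), ← h2, Matrix.sum_apply, map_sum]
  conv_lhs => rw [← b.sum_repr v, map_sum, Matrix.sum_apply]
  refine Finset.sum_congr rfl fun l _ => ?_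
  rw [map_smul, Matrix.smul_apply, Matrix.smul_apply, Matrix.map_apply, smul_eq_mul, smul_eq_mul,
    mul_comm (matrixExtend _ _ _), hf, h1, mul_comm]
  rfl

end LinearExtension

/-! ### Polynomial identities involving the inverse matrix. -/

section Inverse

universe u

variable {K : Type*} [Field K] {n : ℕ}

/-- Entries of the inverse are entries of the adjugate divided by the determinant. The same `f`
serves all `C`, so it can be evaluated both on `G` and at a point of `G`. -/
theorem exists_polynomial_det_pow_mul {B : Type u} [CommRing B]
    (q : MvPolynomial ((Fin n × Fin n) ⊕ (Fin n × Fin n)) B) :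
    ∃ (N : ℕ) (f : MvPolynomial (Fin n × Fin n) B), ∀ (C : Type u) [CommRing C] [Algebra B C]
      (M M' : Matrix (Fin n) (Fin n) C), M * M' = 1 →
        MvPolynomial.aeval (fun ij => M ij.1 ij.2) f = M.det ^ N *
          MvPolynomial.aeval (Sum.elim (fun ij => M ij.1 ij.2) fun ij => M' ij.1 ij.2) q := by
  induction q using MvPolynomial.induction_on with
  | C c => exact ⟨0, MvPolynomial.C c, fun C _ _ M M' h => by simp⟩
  | add p q hp hq =>
    obtain ⟨N, f, hf⟩ := hp
    obtain ⟨N', f', hf'⟩ := hq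
    refine ⟨N + N', f * (Matrix.mvPolynomialX (Fin n) (Fin n) B).det ^ N' +
      f' * (Matrix.mvPolynomialX (Fin n) (Fin n) B).det ^ N, fun C _ _ M M' h => ?_⟩
    have hdet : MvPolynomial.aeval (fun ij : Fin n × Fin n => M ij.1 ij.2)
        (Matrix.mvPolynomialX (Fin n) (Fin n) B).det = M.det := by
      rw [AlgHom.map_det, Matrix.mvPolynomialX_mapMatrix_aeval]
    simp only [map_add, map_mul, map_pow, hf C M M' h, hf' C M M' h, hdet]
    ring
  | mul_X p i hp =>
    obtain ⟨N, f, hf⟩ := hp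
    obtain ij | ij := i
    · refine ⟨N, f * MvPolynomial.X ij, fun C _ _ M M' h => ?_⟩
      simp [hf C M M' h, mul_assoc]
    · refine ⟨N + 1, f * (Matrix.mvPolynomialX (Fin n) (Fin n) B).adjugate ij.1 ij.2,
        fun C _ _ M M' h => ?_⟩
      have hadj : MvPolynomial.aeval (fun ij : Fin n × Fin n => M ij.1 ij.2)
          ((Matrix.mvPolynomialX (Fin n) (Fin n) B).adjugate ij.1 ij.2) =
            M.det * M' ij.1 ij.2 := by
        have h1 := AlgHom.map_adjugate
          (MvPolynomial.aeval (R := B) (fun ij : Fin n × Fin n => M ij.1 ij.2))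
          (Matrix.mvPolynomialX (Fin n) (Fin n) B)
        rw [Matrix.mvPolynomialX_mapMatrix_aeval] at h1
        have h2 : M.adjugate = M.det • M' := by
          rw [← Matrix.mul_one M.adjugate, ← h, ← Matrix.mul_assoc, Matrix.adjugate_mul,
            Matrix.smul_mul, Matrix.one_mul]
        rw [h2] at h1
        exact congrFun (congrFun h1 ij.1) ij.2
      simp only [map_mul, hf C M M' h, hadj, MvPolynomial.aeval_X, Sum.elim_inr]
      ring

/-- A polynomial identity in the entries of `a` and `a⁻¹`, valid for all `a ∈ G`, holds for all
invertible points of `G`. -/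
theorem aeval_inverse_eq_zero_of_isPointOf {G : Subgroup (GL (Fin n) K)} {B C : Type u}
    [CommRing B] [Algebra K B] [CommRing C] [Algebra K C] [Algebra B C] [IsScalarTower K B C]
    {q : MvPolynomial ((Fin n × Fin n) ⊕ (Fin n × Fin n)) B}
    (hq : ∀ a ∈ G, MvPolynomial.aeval (Sum.elim
      (fun ij => algebraMap K B (a.val ij.1 ij.2))
      fun ij => algebraMap K B (a⁻¹.val ij.1 ij.2)) q = 0)
    {M M' : Matrix (Fin n) (Fin n) C} (hM : IsPointOf G M) (hMM' : M * M' = 1) :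
    MvPolynomial.aeval (Sum.elim (fun ij => M ij.1 ij.2) fun ij => M' ij.1 ij.2) q = 0 := by
  obtain ⟨N, f, hf⟩ := exists_polynomial_det_pow_mul q
  have h1 : MvPolynomial.aeval (fun ij => M ij.1 ij.2) f = 0 := by
    refine aeval_eq_zero_of_isPointOf (fun a ha => ?_) hM
    rw [← MvPolynomial.aeval_eq_eval]
    have h := hf B (a.val.map (algebraMap K B)) (a⁻¹.val.map (algebraMap K B)) (by
      rw [← Matrix.map_mul, ← Units.val_mul, mul_inv_cancel]
      simp)
    exact h.trans ((congrArg _ (hq a ha)).trans (mul_zero _))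
  have h2 : IsUnit (M.det ^ N) := by
    apply IsUnit.pow
    refine IsUnit.of_mul_eq_one M'.det ?_
    rw [← Matrix.det_mul, hMM', Matrix.det_one]
  rw [hf C M M' hMM'] at h1
  exact (h2.mul_right_eq_zero).1 h1

end Inverse

/-! ### Descent to the constants of a family of derivations. -/

section Descent

variable {K L κ : Type*} [Field K] [Field L] [Algebra K L]

/-- Applying a derivation to the coefficients of a polynomial, and the chain rule. -/
theorem exists_coeff_derivation (D : Derivation K L L) (P : MvPolynomial κ L) :
    ∃ Q : MvPolynomial κ L, (∀ m, Q.coeff m = D (P.coeff m)) ∧ ∀ y : κ → L,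
      D (MvPolynomial.aeval y P) = MvPolynomial.aeval y Q +
        (MvPolynomial.aeval (fun i => TrivSqZeroExt.inl (y i) + TrivSqZeroExt.inr (D (y i)) :
          κ → TrivSqZeroExt L L) P).snd := by
  classical
  induction P using MvPolynomial.induction_on with
  | C c =>
    refine ⟨MvPolynomial.C (D c), fun m => ?_, fun y => ?_⟩
    · rw [MvPolynomial.coeff_C, MvPolynomial.coeff_C]
      split_ifs <;> simp
    · simp [TrivSqZeroExt.algebraMap_eq_inl']
  | add p q hp hq =>
    obtain ⟨P', h1, h2⟩ := hp
    obtain ⟨Q', h3, h4⟩ := hq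
    refine ⟨P' + Q', fun m => by simp [h1, h3], fun y => ?_⟩
    simp only [map_add, h2, h4, TrivSqZeroExt.snd_add]
    ring
  | mul_X p i hp =>
    obtain ⟨P', h1, h2⟩ := hp
    refine ⟨P' * MvPolynomial.X i, fun m => ?_, fun y => ?_⟩
    · rw [MvPolynomial.coeff_mul_X', MvPolynomial.coeff_mul_X']
      split_ifs <;> simp [h1]
    · simp only [map_mul, D.leibniz, h2, MvPolynomial.aeval_X, TrivSqZeroExt.snd_mul,
        fst_aeval_inl_add_inr, smul_eq_mul, op_smul_eq_smul, TrivSqZeroExt.fst_add,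
        TrivSqZeroExt.snd_add, TrivSqZeroExt.fst_inl, TrivSqZeroExt.fst_inr,
        TrivSqZeroExt.snd_inl, TrivSqZeroExt.snd_inr, add_zero, zero_add]
      ring

/-- A space of polynomials stable under applying derivations to the coefficients contains a
non-zero polynomial with constant coefficients. -/
theorem exists_mem_coeff_constant {τ : Type*} (D : τ → Derivation K L L)
    (N : Submodule L (MvPolynomial κ L))
    (hN : ∀ t, ∀ P ∈ N, ∀ Q : MvPolynomial κ L, (∀ m, Q.coeff m = D t (P.coeff m)) → Q ∈ N)
    (hne : N ≠ ⊥) : ∃ P ∈ N, P ≠ 0 ∧ ∀ t m, D t (P.coeff m) = 0 := by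
  classical
  obtain ⟨P₀, hP₀, hP₀0⟩ := N.ne_bot_iff.1 hne
  -- Take a nonzero element of minimal support and scale one coefficient to `1`. Differentiating its
  -- coefficients kills that one and creates no new monomial, so minimality forces the result to be
  -- zero.
  have hex : ∃ k, ∃ P ∈ N, P ≠ 0 ∧ P.support.card = k := ⟨_, P₀, hP₀, hP₀0, rfl⟩
  obtain ⟨P, hP, hP0, hcard⟩ := Nat.find_spec hex
  obtain ⟨m₀, hm₀⟩ := MvPolynomial.ne_zero_iff.1 hP0
  refine ⟨(P.coeff m₀)⁻¹ • P, N.smul_mem _ hP, smul_ne_zero (inv_ne_zero hm₀) hP0,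
    fun t m => ?_⟩
  obtain ⟨Q, hQ, -⟩ := exists_coeff_derivation (D t) ((P.coeff m₀)⁻¹ • P)
  have hQN := hN t _ (N.smul_mem _ hP) Q hQ
  by_contra hm
  rw [← hQ] at hm
  have hQ0 : Q ≠ 0 := MvPolynomial.ne_zero_iff.2 ⟨m, hm⟩
  have hlt : Q.support.card < P.support.card := by
    apply Finset.card_lt_card
    rw [Finset.ssubset_iff_of_subset]
    · refine ⟨m₀, MvPolynomial.mem_support_iff.2 hm₀, ?_⟩
      rw [MvPolynomial.notMem_support_iff, hQ, MvPolynomial.coeff_smul, smul_eq_mul,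
        inv_mul_cancel₀ hm₀, Derivation.map_one_eq_zero]
    · intro m' hm'
      rw [MvPolynomial.mem_support_iff, hQ] at hm'
      rw [MvPolynomial.mem_support_iff]
      intro h0
      rw [MvPolynomial.coeff_smul, h0, smul_zero, map_zero] at hm'
      exact hm' rfl
  rw [hcard] at hlt
  exact Nat.find_min hex hlt ⟨Q, hQN, hQ0, rfl⟩

end Descent

/-! ### Algebraic independence of the coordinates along the generic orbit. -/

section GenericOrbit

variable {K g ι : Type*} [Field K] [LieRing g] [LieAlgebra K g] {n : ℕ}

/-- The inclusion of `g` in `Frac S(g)`. -/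
def toFracSym (K g : Type*) [Field K] [LieRing g] [LieAlgebra K g] : g →ₗ[K] FracSym K g :=
  (IsScalarTower.toAlgHom K (SymmetricAlgebra K g) (FracSym K g)).toLinearMap ∘ₗ
    SymmetricAlgebra.ι K g

theorem fracAd_toFracSym (v w : g) : fracAd v (toFracSym K g w) = toFracSym K g ⁅v, w⁆ := by
  refine (fracAd_algebraMap v _).trans ?_
  rw [adAction, symDerivation_ι]
  rfl

/-- Over the `K`-algebra `C`, the polynomial `P` in the values of the linear functional `φ` on
conjugates of matrices, as a polynomial in the entries of the conjugating matrix and its inverse. -/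
def conjPoly {L κ : Type*} [CommRing L] [Algebra K L] (φ : Matrix (Fin n) (Fin n) K →ₗ[K] L)
    (X : κ → Matrix (Fin n) (Fin n) K) (P : MvPolynomial κ L) :
    MvPolynomial ((Fin n × Fin n) ⊕ (Fin n × Fin n)) L :=
  MvPolynomial.aeval (fun k => matrixExtend φ _
    (Matrix.of (fun i j => MvPolynomial.X (Sum.inr (i, j))) *
      (X k).map (algebraMap K (MvPolynomial ((Fin n × Fin n) ⊕ (Fin n × Fin n)) L)) *
      Matrix.of (fun i j => MvPolynomial.X (Sum.inl (i, j))))) P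

theorem aeval_conjPoly {L κ : Type*} [CommRing L] [Algebra K L]
    (φ : Matrix (Fin n) (Fin n) K →ₗ[K] L) (X : κ → Matrix (Fin n) (Fin n) K)
    (P : MvPolynomial κ L) {C : Type*} [CommRing C] [Algebra K C] [Algebra L C]
    [IsScalarTower K L C] (M M' : Matrix (Fin n) (Fin n) C) :
    MvPolynomial.aeval (Sum.elim (fun ij => M ij.1 ij.2) fun ij => M' ij.1 ij.2)
        (conjPoly φ X P) =
      MvPolynomial.aeval
        (fun k => matrixExtend φ C (M' * (X k).map (algebraMap K C) * M)) P := by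
  rw [conjPoly, ← AlgHom.comp_apply, MvPolynomial.comp_aeval]
  congr 2
  ext k
  rw [map_matrixExtend]
  congr 1
  set f := MvPolynomial.aeval (R := L)
    (Sum.elim (fun ij : Fin n × Fin n => M ij.1 ij.2) fun ij : Fin n × Fin n => M' ij.1 ij.2)
  have hf : ∀ c : K, f (algebraMap K _ c) = algebraMap K C c := fun c => by
    rw [IsScalarTower.algebraMap_apply K L, AlgHom.commutes, ← IsScalarTower.algebraMap_apply]
  ext i j
  simp only [Matrix.map_apply, Matrix.mul_apply, map_sum, map_mul, Matrix.of_apply, hf]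
  simp [f]

variable {G : Subgroup (GL (Fin n) K)} {ρ : g →ₗ[K] Matrix (Fin n) (Fin n) K}
  {π : Matrix (Fin n) (Fin n) K →ₗ[K] g}

theorem exists_conj_eq (hρ : Set.range ρ = lieAlgebraOf G) {a : GL (Fin n) K} (ha : a ∈ G)
    (v : g) : ∃ u, ρ u = a⁻¹.val * ρ v * a.val := by
  have h : ρ v ∈ lieAlgebraOf G := hρ ▸ Set.mem_range_self v
  have h1 := conj_mem_lieAlgebraOf h ha
  rwa [← hρ] at h1

theorem dualMatrix_one_zero {R : Type*} [CommRing R] :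
    dualMatrix (1 : Matrix (Fin n) (Fin n) R) 0 = 1 := by
  ext i j <;> by_cases hij : i = j <;> simp [dualMatrix, Matrix.one_apply, hij]

theorem dualMatrix_map_algebraMap {R : Type*} [CommRing R] [Algebra K R]
    (X : Matrix (Fin n) (Fin n) K) :
    X.map (algebraMap K (TrivSqZeroExt R R)) = dualMatrix (X.map (algebraMap K R)) 0 := by
  ext i j <;> simp [dualMatrix, TrivSqZeroExt.algebraMap_eq_inl']

theorem dualMatrix_mul_inverse {R : Type*} [CommRing R] (A A' W : Matrix (Fin n) (Fin n) R) :
    dualMatrix A 0 * dualMatrix 1 (-W) * (dualMatrix 1 W * dualMatrix A' 0) =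
      dualMatrix (A * A') 0 := by
  simp only [dualMatrix_mul]
  congr 1
  · simp
  · simp [Matrix.mul_assoc]

theorem dualMatrix_conj {R : Type*} [CommRing R] (A A' W X : Matrix (Fin n) (Fin n) R) :
    dualMatrix 1 W * dualMatrix A' 0 * dualMatrix X 0 * (dualMatrix A 0 * dualMatrix 1 (-W)) =
      dualMatrix (A' * X * A) (W * (A' * X * A) - A' * X * A * W) := by
  simp only [dualMatrix_mul]
  congr 1
  · simp
  · simp only [Matrix.mul_zero, add_zero, zero_add, Matrix.one_mul,
      Matrix.mul_one, Matrix.mul_neg, Matrix.mul_assoc]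
    abel

/-- Polynomial relations between linear functionals of the conjugates of matrices by the elements
of `G` can be differentiated in the directions of the Lie algebra of `G`. -/
theorem aeval_conj_dual_eq_zero {κ : Type*} {L : Type*} [CommRing L] [Algebra K L]
    (φ : Matrix (Fin n) (Fin n) K →ₗ[K] L) (X : κ → Matrix (Fin n) (Fin n) K)
    {P : MvPolynomial κ L}
    (hP : ∀ a ∈ G, MvPolynomial.aeval (fun k => φ (a⁻¹.val * X k * a.val)) P = 0)
    {a : GL (Fin n) K} (ha : a ∈ G) {W : Matrix (Fin n) (Fin n) K} (hW : -W ∈ lieAlgebraOf G) :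
    MvPolynomial.aeval (fun k =>
      TrivSqZeroExt.inl (φ (a⁻¹.val * X k * a.val)) +
      TrivSqZeroExt.inr (φ (W * (a⁻¹.val * X k * a.val) - a⁻¹.val * X k * a.val * W)) :
        κ → TrivSqZeroExt L L) P = 0 := by
  have hq : ∀ a ∈ G, MvPolynomial.aeval (Sum.elim
      (fun ij : Fin n × Fin n => algebraMap K L (a.val ij.1 ij.2))
      fun ij : Fin n × Fin n => algebraMap K L (a⁻¹.val ij.1 ij.2)) (conjPoly φ X P) = 0 := by
    intro a ha
    refine (aeval_conjPoly φ X P (a.val.map (algebraMap K L))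
      (a⁻¹.val.map (algebraMap K L))).trans ?_
    rw [← hP a ha]
    congr 2
    ext k
    rw [← Matrix.map_mul, ← Matrix.map_mul, matrixExtend_map_algebraMap]
    rfl
  -- The relation is evaluated at the point `a (1 - ε W)` of `G`, with inverse `(1 + ε W) a⁻¹`;
  -- conjugation by it turns `X` into `a⁻¹ X a + ε [W, a⁻¹ X a]`.
  have hcc' := dualMatrix_mul_inverse (a.val.map (algebraMap K L)) (a⁻¹.val.map (algebraMap K L))
    (W.map (algebraMap K L))
  rw [← Matrix.map_mul, ← Units.val_mul, mul_inv_cancel, Units.val_one,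
    Matrix.map_one _ (map_zero _) (map_one _), dualMatrix_one_zero] at hcc'
  have hcpt : IsPointOf G (dualMatrix (a.val.map (algebraMap K L)) 0 *
      dualMatrix 1 (-(W.map (algebraMap K L)))) := by
    refine ((isPointOf_of_mem ha).map (Algebra.ofId K L)).dualMatrix_zero.mul ?_
    have h := isPointOf_dualMatrix_map (R := L) hW
    have hneg : (-W).map (algebraMap K L) = -(W.map (algebraMap K L)) := by
      ext i j
      simp
    rwa [hneg] at h
  have h := aeval_inverse_eq_zero_of_isPointOf hq hcpt hcc'
  rw [aeval_conjPoly] at h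
  rw [← h]
  congr 2
  ext1 k
  rw [dualMatrix_map_algebraMap, dualMatrix_conj, ← Matrix.map_mul, ← Matrix.map_mul,
    ← Matrix.map_mul, ← Matrix.map_mul, ← Matrix.map_sub _ (fun x y => map_sub _ x y),
    matrixExtend_dualMatrix, matrixExtend_map_algebraMap, matrixExtend_map_algebraMap]
  rfl

/-- Relations between the coordinates of the generic orbit are stable under the adjoint action on
the coefficients. -/
theorem aeval_orbit_dual_eq_zero (hρ : Set.range ρ = lieAlgebraOf G)
    (hbr : ∀ v w : g, ρ ⁅v, w⁆ = ρ v * ρ w - ρ w * ρ v) (hπ : ∀ v, π (ρ v) = v)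
    {κ : Type*} (x : κ → g) {P : MvPolynomial κ (FracSym K g)}
    (hP : ∀ a ∈ G, MvPolynomial.aeval
      (fun k => toFracSym K g (π (a⁻¹.val * ρ (x k) * a.val))) P = 0)
    {a : GL (Fin n) K} (ha : a ∈ G) (w : g) :
    MvPolynomial.aeval (fun k =>
      TrivSqZeroExt.inl (toFracSym K g (π (a⁻¹.val * ρ (x k) * a.val))) +
      TrivSqZeroExt.inr (fracAd w (toFracSym K g (π (a⁻¹.val * ρ (x k) * a.val)))) :
        κ → TrivSqZeroExt (FracSym K g) (FracSym K g)) P = 0 := by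
  have hw : -ρ w ∈ lieAlgebraOf G := by
    rw [← hρ, ← map_neg]
    exact Set.mem_range_self _
  have h := aeval_conj_dual_eq_zero (toFracSym K g ∘ₗ π) (fun k => ρ (x k)) hP ha hw
  rw [← h]
  congr 2
  ext1 k
  obtain ⟨u, hu⟩ := exists_conj_eq hρ ha (x k)
  rw [← hu, ← hbr, LinearMap.comp_apply, LinearMap.comp_apply, hπ, hπ, fracAd_toFracSym]

/-- Applying `ad w` to a relation yields the relation with differentiated coefficients plus a
first-order variation, which `aeval_orbit_dual_eq_zero` shows to vanish. So the space `N` of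
relations is stable, and descent gives a nonzero relation with invariant coefficients; at `a = 1` it
contradicts `hx`. -/
theorem exists_aeval_orbit_ne_zero (hρ : Set.range ρ = lieAlgebraOf G)
    (hbr : ∀ v w : g, ρ ⁅v, w⁆ = ρ v * ρ w - ρ w * ρ v) (hπ : ∀ v, π (ρ v) = v)
    {κ : Type*} {x : κ → g}
    (hx : AlgebraicIndependent (invariantField K g) fun k => toFracSym K g (x k))
    {P : MvPolynomial κ (FracSym K g)} (hP : P ≠ 0) :
    ∃ a ∈ G, MvPolynomial.aeval
      (fun k => toFracSym K g (π (a⁻¹.val * ρ (x k) * a.val))) P ≠ 0 := by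
  by_contra! hcon
  let N : Submodule (FracSym K g) (MvPolynomial κ (FracSym K g)) :=
    { carrier := {P | ∀ a ∈ G, MvPolynomial.aeval
        (fun k => toFracSym K g (π (a⁻¹.val * ρ (x k) * a.val))) P = 0}
      add_mem' := fun {p q} hp hq a ha => by rw [map_add, hp a ha, hq a ha, add_zero]
      zero_mem' := fun a _ => map_zero _
      smul_mem' := fun c p hp a ha => by rw [map_smul, hp a ha, smul_zero] }
  have hN : ∀ w : g, ∀ P ∈ N, ∀ Q : MvPolynomial κ (FracSym K g),
      (∀ m, Q.coeff m = fracAd w (P.coeff m)) → Q ∈ N := by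
    intro w P hP Q hQ a ha
    obtain ⟨Q', hQ', h⟩ := exists_coeff_derivation (fracAd w) P
    have hQQ : Q = Q' := MvPolynomial.ext _ _ fun m => by rw [hQ, hQ']
    have h1 := h fun k => toFracSym K g (π (a⁻¹.val * ρ (x k) * a.val))
    rw [hP a ha, aeval_orbit_dual_eq_zero hρ hbr hπ x hP ha w, map_zero, TrivSqZeroExt.snd_zero,
      add_zero] at h1
    rw [hQQ]
    exact h1.symm
  obtain ⟨P', hP'N, hP'0, hP'⟩ := exists_mem_coeff_constant (fun w : g => fracAd w) N hN
    ((Submodule.ne_bot_iff _).2 ⟨P, hcon, hP⟩)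
  have hmem : P' ∈ Set.range
      (MvPolynomial.map (σ := κ) (algebraMap (invariantField K g) (FracSym K g))) := by
    rw [MvPolynomial.mem_range_map_iff_coeffs_subset]
    intro c hc
    obtain ⟨m, -, rfl⟩ := MvPolynomial.mem_coeffs_iff.1 hc
    exact ⟨⟨P'.coeff m, fun w => hP' w m⟩, rfl⟩
  obtain ⟨R, rfl⟩ := hmem
  have h := hP'N 1 (one_mem G)
  simp only [inv_one, Units.val_one, Matrix.one_mul, Matrix.mul_one, hπ] at h
  rw [MvPolynomial.aeval_map_algebraMap] at h
  have hR : R = 0 := hx (h.trans (map_zero _).symm)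
  rw [hR, map_zero] at hP'0
  exact hP'0 rfl

end GenericOrbit

/-! ### The dimension of the generic orbit is at most the generic rank. -/

section OrbitDimension

universe u

/-- Meant for the ring `R` of all functions `G → L`, which can have zero divisors. The images of
nonzero polynomials form a multiplicative set avoiding `0`, so some prime is disjoint from it, and
`E` is the fraction field of the quotient. -/
theorem exists_field_algebraicIndependent {L κ : Type*} {R : Type u} [Field L] [CommRing R] [Algebra L R]
    (Φ : MvPolynomial κ L →ₐ[L] R) (hΦ : Function.Injective Φ) :
    ∃ (E : Type u) (_ : Field E) (_ : Algebra L E) (f : R →ₐ[L] E),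
      AlgebraicIndependent L fun k => f (Φ (MvPolynomial.X k)) := by
  let S : Submonoid R := (nonZeroDivisors (MvPolynomial κ L)).map Φ
  have hdisj : Disjoint ((⊥ : Ideal R) : Set R) S := by
    rw [Set.disjoint_left]
    rintro _ h ⟨P, hP, rfl⟩
    exact nonZeroDivisors.ne_zero hP (hΦ ((Ideal.mem_bot.1 h).trans (map_zero Φ).symm))
  obtain ⟨𝔭, h𝔭, -, hS⟩ := Ideal.exists_le_prime_disjoint ⊥ S hdisj
  let f : R →ₐ[L] FractionRing (R ⧸ 𝔭) :=
    (IsScalarTower.toAlgHom L (R ⧸ 𝔭) (FractionRing (R ⧸ 𝔭))).comp (Ideal.Quotient.mkₐ L 𝔭)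
  refine ⟨FractionRing (R ⧸ 𝔭), inferInstance, inferInstance, f, ?_⟩
  have h : MvPolynomial.aeval (fun k => f (Φ (MvPolynomial.X k))) = f.comp Φ := by
    ext k
    simp
  rw [AlgebraicIndependent, h, injective_iff_map_eq_zero]
  intro P hP
  by_contra hP0
  have h1 : algebraMap (R ⧸ 𝔭) (FractionRing (R ⧸ 𝔭)) (Ideal.Quotient.mk 𝔭 (Φ P)) = 0 := hP
  rw [FaithfulSMul.algebraMap_eq_zero_iff, Ideal.Quotient.eq_zero_iff_mem] at h1
  exact Set.disjoint_left.1 hS h1 ⟨P, mem_nonZeroDivisors_of_ne_zero hP0, rfl⟩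

theorem derivation_map_matrix_mul {K E : Type*} [CommRing K] [CommRing E] [Algebra K E] {n : ℕ}
    (D : Derivation K E E) (A B : Matrix (Fin n) (Fin n) E) :
    (A * B).map D = A.map D * B + A * B.map D := by
  ext i j
  simp [Matrix.mul_apply, Finset.sum_add_distrib, mul_comm, add_comm]

variable {K g ι : Type*} [Field K] [LieRing g] [LieAlgebra K g] {n : ℕ}
  {G : Subgroup (GL (Fin n) K)} {ρ : g →ₗ[K] Matrix (Fin n) (Fin n) K}
  {π : Matrix (Fin n) (Fin n) K →ₗ[K] g}

/-- Differentiating `γ * (γ' * Z * γ) = Z * γ` avoids the derivative of the inverse. -/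
theorem derivation_conj {E : Type*} [CommRing E] [Algebra K E] (D : Derivation K E E)
    {γ γ' : Matrix (Fin n) (Fin n) E} (h : γ * γ' = 1) (h' : γ' * γ = 1)
    (X : Matrix (Fin n) (Fin n) K) :
    (γ' * X.map (algebraMap K E) * γ).map D =
      γ' * X.map (algebraMap K E) * γ * (γ' * γ.map D) -
        γ' * γ.map D * (γ' * X.map (algebraMap K E) * γ) := by
  set Z := X.map (algebraMap K E)
  have hZ : Z.map D = 0 := by
    ext i j
    simp [Z]
  have h1 := congrArg (fun M : Matrix (Fin n) (Fin n) E => γ' * M.map D)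
    (show γ * (γ' * Z * γ) = Z * γ by
      rw [← Matrix.mul_assoc, ← Matrix.mul_assoc, h, Matrix.one_mul])
  simp only [derivation_map_matrix_mul D γ (γ' * Z * γ), derivation_map_matrix_mul D Z γ, hZ,
    Matrix.zero_mul, zero_add, Matrix.mul_add] at h1
  rw [← Matrix.mul_assoc γ' γ, h', Matrix.one_mul] at h1
  rw [eq_sub_iff_add_eq, add_comm, Matrix.mul_assoc γ' (γ.map D), h1, Matrix.mul_assoc (γ' * Z),
    ← Matrix.mul_assoc γ γ', h, Matrix.one_mul, Matrix.mul_assoc]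

/-- The transcendence degree of a point of the generic orbit is at most the rank of the Poisson
bracket. -/
theorem card_le_genericRank_of_isPointOf [CharZero K] [Fintype ι]
    (hρ : Set.range ρ = lieAlgebraOf G)
    (hbr : ∀ v w : g, ρ ⁅v, w⁆ = ρ v * ρ w - ρ w * ρ v) (hπ : ∀ v, π (ρ v) = v)
    (b : Module.Basis ι K g) {E : Type*} [Field E] [Algebra K E] [Algebra (FracSym K g) E]
    [IsScalarTower K (FracSym K g) E] {γ γ' : Matrix (Fin n) (Fin n) E} (hγ : IsPointOf G γ)
    (hγ' : IsPointOf G γ') (h : γ * γ' = 1) (h' : γ' * γ = 1) {κ : Type*} [Fintype κ]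
    {x : κ → g} {a : κ → ι → E}
    (ha : ∀ k, γ' * (ρ (x k)).map (algebraMap K E) * γ =
      ∑ l, a k l • (ρ (b l)).map (algebraMap K E))
    (hind : AlgebraicIndependent (FracSym K g) fun k =>
      matrixExtend (toFracSym K g ∘ₗ π) E (γ' * (ρ (x k)).map (algebraMap K E) * γ)) :
    Fintype.card κ ≤ genericRank b := by
  classical
  have hchar : CharZero (FracSym K g) :=
    charZero_of_injective_algebraMap (algebraMap K (FracSym K g)).injective
  choose D hD using fun j : κ => exists_derivation_of_algebraicIndependent hind
    (fun k => if k = j then 1 else 0)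
  let D' : κ → Derivation K E E := fun j => (D j).restrictScalars K
  -- `1 + ε γ' D(γ)` is the product of the points `γ'` and `γ + ε D(γ)`.
  have hY : ∀ j, IsPointOf G (dualMatrix 1 (γ' * γ.map (D' j))) := fun j => by
    have h1 := hγ'.dualMatrix_zero.mul (hγ.dualMatrix_derivation (D' j))
    rwa [dualMatrix_mul, h', Matrix.zero_mul, add_zero] at h1
  let c : κ → ι → E := fun j m => matrixExtend (b.coord m ∘ₗ π) E (γ' * γ.map (D' j))
  have hc : ∀ j, γ' * γ.map (D' j) = ∑ m, c j m • (ρ (b m)).map (algebraMap K E) := fun j =>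
    eq_sum_of_isPointOf_dualMatrix_one hρ hπ b (hY j)
  let P : Matrix ι ι (FracSym K g) :=
    (poissonMatrix b).map (algebraMap (SymmetricAlgebra K g) (FracSym K g))
  have hcomm : ∀ l m, (ρ (b l)).map (algebraMap K E) * (ρ (b m)).map (algebraMap K E) -
      (ρ (b m)).map (algebraMap K E) * (ρ (b l)).map (algebraMap K E) =
        (ρ ⁅b l, b m⁆).map (algebraMap K E) := fun l m => by
    rw [hbr, Matrix.map_sub _ (fun x y => map_sub (algebraMap K E) x y), Matrix.map_mul,
      Matrix.map_mul]
  -- Differentiating the `k`-th coordinate by the `L`-linear `D j` gives `∑ a k l * c j m * [b l, b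
  -- m]`, the `(k, j)` entry of the product; by duality it is `1` or `0`.
  have hmat : Matrix.of a * P.map (algebraMap (FracSym K g) E) * (Matrix.of c).transpose = 1 := by
    ext k j
    rw [Matrix.one_apply, ← hD j k, derivation_matrixExtend]
    have h1 : (γ' * (ρ (x k)).map (algebraMap K E) * γ).map (D j) =
        ∑ l, ∑ m, (a k l * c j m) • (ρ ⁅b l, b m⁆).map (algebraMap K E) := by
      refine (derivation_conj (D' j) h h' (ρ (x k))).trans ?_
      rw [ha, hc]
      simp only [Matrix.sum_mul, Matrix.mul_sum, Matrix.smul_mul, Matrix.mul_smul, Finset.smul_sum,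
        smul_smul, ← hcomm, smul_sub, Finset.sum_sub_distrib]
      congr 1
      rw [Finset.sum_comm]
      refine Finset.sum_congr rfl fun l _ => Finset.sum_congr rfl fun m _ => ?_
      rw [mul_comm]
    rw [h1]
    simp only [map_sum, map_smul, matrixExtend_map_algebraMap, LinearMap.comp_apply, hπ,
      smul_eq_mul, Matrix.mul_apply, Finset.sum_mul, Matrix.of_apply, Matrix.map_apply,
      Matrix.transpose_apply]
    rw [Finset.sum_comm]
    refine Finset.sum_congr rfl fun l _ => Finset.sum_congr rfl fun m _ => ?_
    change a k l * algebraMap (FracSym K g) E (toFracSym K g ⁅b l, b m⁆) * c j m = _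
    ring
  have h1 := Matrix.rank_one (R := E) (n := κ)
  rw [← h1, ← hmat]
  exact (Matrix.rank_mul_le_left _ _).trans ((Matrix.rank_mul_le_right _ _).trans
    (rank_map_le (algebraMap (FracSym K g) E) P))

theorem isPointOf_pi {X : Type*} {C : Type*} [CommRing C] [Algebra K C]
    {M : Matrix (Fin n) (Fin n) (X → C)}
    (hM : ∀ a, IsPointOf G (Matrix.of fun i j => M i j a)) : IsPointOf G M := by
  intro p hp
  ext a
  have h : Pi.evalAlgHom K (fun _ : X => C) a
      (MvPolynomial.aeval (fun ij => M ij.1 ij.2) p) =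
        MvPolynomial.aeval (fun ij => M ij.1 ij.2 a) p := by
    rw [← AlgHom.comp_apply, MvPolynomial.comp_aeval]
    rfl
  exact h.trans (hM a p hp)

/-- For an algebraic Lie algebra, the transcendence degree of `Frac S(g)` over the field of
invariants is at most the rank of the Poisson bracket. -/
theorem card_le_genericRank [CharZero K] [Fintype ι] (hg : IsAlgebraic K g)
    (b : Module.Basis ι K g) {κ : Type*} [Fintype κ] {x : κ → g}
    (hx : AlgebraicIndependent (invariantField K g) fun k => toFracSym K g (x k)) :
    Fintype.card κ ≤ genericRank b := by
  obtain ⟨n, G, ρ, -, hinj, hbr, hρ⟩ := hg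
  obtain ⟨π, hπ'⟩ := ρ.exists_leftInverse_of_injective (LinearMap.ker_eq_bot.2 hinj)
  have hπ : ∀ v, π (ρ v) = v := fun v => LinearMap.congr_fun hπ' v
  let L := FracSym K g
  let Φ : MvPolynomial κ L →ₐ[L] (G → L) := MvPolynomial.aeval
    fun k a => toFracSym K g (π (a⁻¹.val.val * ρ (x k) * a.val.val))
  have hΦ : Function.Injective Φ := by
    rw [injective_iff_map_eq_zero]
    intro P hP
    by_contra hP0
    obtain ⟨a, ha, h⟩ := exists_aeval_orbit_ne_zero hρ hbr hπ hx hP0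
    apply h
    have h1 := congrArg (Pi.evalAlgHom L (fun _ : G => L) ⟨a, ha⟩) hP
    rw [← AlgHom.comp_apply, MvPolynomial.comp_aeval, map_zero] at h1
    exact h1
  obtain ⟨E, _, _, f, hf⟩ := exists_field_algebraicIndependent Φ hΦ
  let _ : Algebra K E := ((algebraMap L E).comp (algebraMap K L)).toAlgebra
  have : IsScalarTower K L E := IsScalarTower.of_algebraMap_eq fun _ => rfl
  -- The tautological point of `G` with values in functions on `G`; its image in `E` is the point
  -- `γ` to be differentiated.
  let Γ : Matrix (Fin n) (Fin n) (G → L) := Matrix.of fun i j a => algebraMap K L (a.val.val i j)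
  let Γ' : Matrix (Fin n) (Fin n) (G → L) :=
    Matrix.of fun i j a => algebraMap K L (a⁻¹.val.val i j)
  have hΓ : IsPointOf G Γ := isPointOf_pi fun a =>
    (isPointOf_of_mem a.2).map (Algebra.ofId K L)
  have hΓ' : IsPointOf G Γ' := isPointOf_pi fun a =>
    (isPointOf_of_mem a⁻¹.2).map (Algebra.ofId K L)
  have hmul : ∀ (M N : G → Matrix (Fin n) (Fin n) K),
      (Matrix.of fun i j a => algebraMap K L (M a i j) : Matrix (Fin n) (Fin n) (G → L)) *
        (Matrix.of fun i j a => algebraMap K L (N a i j) : Matrix (Fin n) (Fin n) (G → L)) =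
      (Matrix.of fun i j a => algebraMap K L ((M a * N a) i j)) := fun M N => by
    ext i j a
    simp [Matrix.mul_apply]
  have hone : (Matrix.of fun i j a => algebraMap K L ((1 : Matrix (Fin n) (Fin n) K) i j) :
      Matrix (Fin n) (Fin n) (G → L)) = 1 := by
    ext i j a
    by_cases hij : i = j <;> simp [hij, Matrix.one_apply]
  have hΓΓ' : Γ * Γ' = 1 := by
    rw [← hone]
    refine (hmul (fun a => a.val.val) fun a => a⁻¹.val.val).trans ?_
    simp only [← Units.val_mul, ← Subgroup.coe_mul, mul_inv_cancel]
    rfl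
  have hΓ'Γ : Γ' * Γ = 1 := by
    rw [← hone]
    refine (hmul (fun a => a⁻¹.val.val) fun a => a.val.val).trans ?_
    simp only [← Units.val_mul, ← Subgroup.coe_mul, inv_mul_cancel]
    rfl
  have hconj : ∀ v, Γ' * (ρ v).map (algebraMap K (G → L)) * Γ =
      Matrix.of fun i j a => algebraMap K L ((a⁻¹.val.val * ρ v * a.val.val) i j) := fun v => by
    refine (congrArg (· * Γ) (hmul (fun a => a⁻¹.val.val) fun _ => ρ v)).trans ?_
    exact hmul _ _
  have hu : ∀ k (a : G), ∃ u, ρ u = a⁻¹.val.val * ρ (x k) * a.val.val := fun k a =>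
    exists_conj_eq hρ a.2 (x k)
  choose u hu using hu
  have hmapf : ∀ v, f.mapMatrix (Γ' * (ρ v).map (algebraMap K (G → L)) * Γ) =
      Γ'.map f * (ρ v).map (algebraMap K E) * Γ.map f := fun v => by
    have hX : f.mapMatrix ((ρ v).map (algebraMap K (G → L))) = (ρ v).map (algebraMap K E) := by
      ext i j
      exact (f.restrictScalars K).commutes _
    rw [map_mul, map_mul, hX]
    rfl
  refine card_le_genericRank_of_isPointOf hρ hbr hπ b (γ := Γ.map f) (γ' := Γ'.map f)
    (x := x) (a := fun k l => f fun a => algebraMap K L (b.coord l (u k a)))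
    (hΓ.map (f.restrictScalars K)) (hΓ'.map (f.restrictScalars K)) ?_ ?_ ?_ ?_
  · rw [← Matrix.map_mul, hΓΓ', Matrix.map_one _ (map_zero f) (map_one f)]
  · rw [← Matrix.map_mul, hΓ'Γ, Matrix.map_one _ (map_zero f) (map_one f)]
  · intro k
    rw [← hmapf, hconj]
    ext i j
    have h1 : (fun a : G => algebraMap K L ((a⁻¹.val.val * ρ (x k) * a.val.val) i j)) =
        ∑ l, (fun a : G => algebraMap K L (b.coord l (u k a))) *
          algebraMap K (G → L) (ρ (b l) i j) := by
      ext a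
      rw [← hu]
      conv_lhs => rw [← b.sum_repr (u k a), map_sum, Matrix.sum_apply, map_sum]
      rw [Finset.sum_apply]
      refine Finset.sum_congr rfl fun l _ => ?_
      rw [map_smul, Matrix.smul_apply, smul_eq_mul, map_mul]
      rfl
    rw [Matrix.sum_apply]
    refine (congrArg f h1).trans ?_
    rw [map_sum]
    refine Finset.sum_congr rfl fun l _ => ?_
    rw [map_mul]
    congr 1
    exact (f.restrictScalars K).commutes _
  · convert hf using 1
    swap
    · rfl
    ext k
    rw [← hmapf, hconj]
    refine (map_matrixExtend (toFracSym K g ∘ₗ π) f _).symm.trans ?_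
    congr 1
    ext a
    rw [MvPolynomial.aeval_X]
    refine (map_matrixExtend (toFracSym K g ∘ₗ π) (Pi.evalAlgHom L (fun _ : G => L) a)
      (Matrix.of fun i j a => algebraMap K L ((a⁻¹.val.val * ρ (x k) * a.val.val) i j))).trans ?_
    exact matrixExtend_map_algebraMap (toFracSym K g ∘ₗ π) _

end OrbitDimension

end AlgLie

end

theorem proposition2p3 (K g : Type*) [Field K] [IsAlgClosed K] [CharZero K]
    [LieRing g] [LieAlgebra K g] [FiniteDimensional K g] (hg : AlgLie.IsAlgebraic K g) :
    List.TFAE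
      [AlgLie.invariantField K g = AlgLie.fracInvariants K g,
       ∃ p : Fin (AlgLie.index K g) → AlgLie.invariants K g, AlgebraicIndependent K p,
       ∃ U : Set (Module.Dual K g), AlgLie.IsZariskiOpen K U ∧ U.Nonempty ∧
         ∀ x ∈ U, (AlgLie.stabilizer K x : Set g) =
           AlgLie.differentialAt K x '' (AlgLie.invariants K g : Set (SymmetricAlgebra K g))] := by
  tfae_have 1 → 2 := by
    refine AlgLie.exists_algebraicIndependent_of_invariantField_eq (Module.finBasis K g)
      fun I hI => ?_
    have := Fintype.ofFinite I
    rw [Nat.card_eq_fintype_card]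
    exact AlgLie.card_le_genericRank hg (Module.finBasis K g) hI.1
  tfae_have 2 → 1 := fun ⟨_, hp⟩ => AlgLie.invariantField_eq_of_algebraicIndependent hp
  tfae_have 2 → 3 := fun ⟨_, hp⟩ => AlgLie.exists_zariskiOpen_of_algebraicIndependent hp
  tfae_have 3 → 2 := fun ⟨_, _, ⟨x, hxU⟩, h⟩ =>
    AlgLie.exists_algebraicIndependent_of_stabilizer_eq x (h x hxU)
  tfae_finish
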